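/- Let $K$ be a finite group, $p$ a prime number and $\mathbb{F}$ a field of characteristic $0$. \emph{Groups over $K$.} A group over $K$ is a pair $(L,\varphi)$ of a finite group $L$ and a homomorphism $\varphi:L\to K$. A morphism $(L,\varphi)\to(L',\varphi')$ is a group homomorphism $f:L\to L'$ such that $i\circ\varphi=\varphi'\circ f$ for some inner automorphism $i$ of $K$. For a normal subgroup $N$ of a finite group $L$ put $$m_{L,N}=\frac1{|L|}\sum_{X\le L,\ XN=L}|X|\,\mu(X,L),$$ where $\mu$ is the Möbius function of the poset of subgroups of $L$. The group $(L,\varphi)$ over $K$ is a $B_K$-group if $m_{L,N}=0$ for every non-trivial normal subgroup $N$ of $L$ contained in $\operatorname{Ker}\varphi$. \emph{$p$-persistence.} For a finite group $G$ let $B(G)$ be the Burnside group of finite $G$-sets, $\mathbb{F}B(G)=\mathbb{F}\otimes_{\mathbb Z}B(G)$ and $\mathbb{F}B_K(G)=\mathbb{F}B(G\times K)$. A finite $(H,G)$-biset $V$ acts by the linear map $\mathbb{F}B_K(G)\to\mathbb{F}B_K(H)$, $[X]\mapsto[(V\times K)\times_{G\times K}X]$, and there are products $\mathbb{F}B_K(G)\times\mathbb{F}B_K(H)\to\mathbb{F}B_K(G\times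 H)$, $([X],[Y])\mapsto[X\times Y]$, where $(g,h,k)\cdot(x,y)=((g,k)x,(h,k)y)$. An ideal $I$ of $\mathbb{F}B_K$ assigns to each finite group $G$ a subspace $I(G)\subseteq\mathbb{F}B_K(G)$ such that the family is stable under the action of all finite bisets and $\mathbb{F}B_K(G)\times I(H)$ is mapped into $I(G\times H)$ for all $G,H$. For a finite group $\Gamma$ and $S\le\Gamma$ let $$e_S^{\Gamma}=\frac1{|N_{\Gamma}(S)|}\sum_{X\le S}|X|\,\mu(X,S)\,[\Gamma/X]\in\mathbb{F}B(\Gamma).$$ Let $L_\varphi=\{(l,\varphi(l))\mid l\in L\}\le L\times K$, and let $\mathsf{e}_{L,\varphi}$ be the ideal of $\mathbb{F}B_K$ generated by $e_{L_\varphi}^{L\times K}\in\mathbb{F}B_K(L)$. The group $(L,\varphi)$ over $K$ is $p$-persistent if $\mathsf{e}_{L,\varphi}(P)\ne\{0\}$ for some finite $p$-group $P$. \emph{Further notation.} For a finite group $H$ let $O^p(H)$ be the subgroup generated by the elements of order prime to $p$, and $H^{[p]}=H/O^p(H)$. Let $C_p$ be the cyclic group of order $p$. \textbf{Theorem.} Let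 $(L,\varphi)$ be a $p$-persistent $B_K$-group. Let $[s_K]$ be a set of representatives of the conjugacy classes of subgroups of $K$, let $H$ be the unique element of $[s_K]$ conjugate to $\varphi(L)$, and let $j_H:H\hookrightarrow K$ be the inclusion map. Then one and only one of the following holds: \begin{enumerate} \item $\operatorname{Ker}\varphi=\mathbf 1$, and $(L,\varphi)\cong(H,j_H)$ as groups over $K$. \item $\operatorname{Ker}\varphi\cong C_p$, the group $H^{[p]}$ is cyclic and non-trivial, and $(L,\varphi)\cong(C_p\times H,\,j_H\circ\pi_H)$ as groups over $K$, where $\pi_H:C_p\times H\to H$ is the projection. \item $\operatorname{Ker}\varphi\cong C_p\times C_p$, the group $H^{[p]}$ is trivial (that is, $H$ is $p$-perfect), and $(L,\varphi)\cong(C_p\times C_p\times H,\,j_H\circ\pi_H)$ as groups over $K$, where $\pi_H:C_p\times C_p\times H\to H$ is the projection. \end{enumerate} -/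

import Mathlib

universe u w

namespace RelBGroup

/-! ### The Burnside group with coefficients in a field -/

/-- A finite `G`-set. -/
structure FinGSet (G : Type u) [Group G] where
  carrier : Type u
  [fin : Finite carrier]
  [act : MulAction G carrier]

attribute [instance] FinGSet.fin FinGSet.act

namespace FinGSet

variable {G : Type u} [Group G]

/-- Isomorphism of finite `G`-sets. -/
def Iso (X Y : FinGSet G) : Prop :=
  ∃ e : X.carrier ≃ Y.carrier, ∀ (g : G) (x : X.carrier), e (g • x) = g • e x

/-- Disjoint union of finite `G`-sets. -/
def sum (X Y : FinGSet G) : FinGSet G where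
  carrier := X.carrier ⊕ Y.carrier

/-- The transitive `G`-set `G / S`. -/
def coset [Finite G] (S : Subgroup G) : FinGSet G where
  carrier := G ⧸ S

end FinGSet

/-- The relations `[X] = [Y]` for `X ≅ Y`, and `[X ⊔ Y] = [X] + [Y]`. -/
noncomputable def burnsideRel (F : Type w) [Field F] (G : Type u) [Group G] :
    Submodule F (FinGSet G →₀ F) :=
  Submodule.span F
    ({a | ∃ X Y : FinGSet G, X.Iso Y ∧ a = Finsupp.single X 1 - Finsupp.single Y 1} ∪
     {a | ∃ X Y : FinGSet G, a = Finsupp.single (X.sum Y) 1 -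
        (Finsupp.single X 1 + Finsupp.single Y 1)})

/-- `𝔽B(G) = 𝔽 ⊗ B(G)`: the Grothendieck group of finite `G`-sets for disjoint union, with
coefficients extended to `𝔽`. -/
abbrev FB (F : Type w) [Field F] (G : Type u) [Group G] : Type (max (u + 1) w) :=
  (FinGSet G →₀ F) ⧸ burnsideRel F G

namespace FB

variable (F : Type w) [Field F] {G : Type u} [Group G]

/-- The class `[X]` of a finite `G`-set. -/
noncomputable def mk (X : FinGSet G) : FB F G :=
  (burnsideRel F G).mkQ (Finsupp.single X 1)

theorem mk_iso {X Y : FinGSet G} (h : X.Iso Y) : mk F X = mk F Y := by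
  refine (Submodule.Quotient.eq _).2 (Submodule.subset_span (Or.inl ⟨X, Y, h, rfl⟩))

theorem mk_sum (X Y : FinGSet G) : mk F (X.sum Y) = mk F X + mk F Y := by
  refine (Submodule.Quotient.eq _).2 (Submodule.subset_span (Or.inr ⟨X, Y, rfl⟩))

/-- Additive invariants of finite `G`-sets extend linearly to the Burnside group. -/
noncomputable def lift {M : Type*} [AddCommGroup M] [Module F M] (f : FinGSet G → M)
    (hiso : ∀ X Y : FinGSet G, X.Iso Y → f X = f Y)
    (hsum : ∀ X Y : FinGSet G, f (X.sum Y) = f X + f Y) : FB F G →ₗ[F] M :=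
  (burnsideRel F G).liftQ (Finsupp.linearCombination F f) (by
    refine Submodule.span_le.2 ?_
    rintro a (⟨X, Y, h, rfl⟩ | ⟨X, Y, rfl⟩)
    · simp [hiso X Y h]
    · simp [hsum X Y])

@[simp] theorem lift_mk {M : Type*} [AddCommGroup M] [Module F M] (f : FinGSet G → M)
    (hiso : ∀ X Y : FinGSet G, X.Iso Y → f X = f Y)
    (hsum : ∀ X Y : FinGSet G, f (X.sum Y) = f X + f Y) (X : FinGSet G) :
    lift F f hiso hsum (mk F X) = f X := by
  change Finsupp.linearCombination F f (Finsupp.single X 1) = f X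
  simp

theorem hom_ext {M : Type*} [AddCommGroup M] [Module F M] {f g : FB F G →ₗ[F] M}
    (h : ∀ X, f (mk F X) = g (mk F X)) : f = g := by
  refine Submodule.linearMap_qext _ (Finsupp.lhom_ext fun X b => ?_)
  have hb : Finsupp.single X b = b • (Finsupp.single X 1 : FinGSet G →₀ F) := by simp
  rw [hb, map_smul, map_smul]
  exact congrArg (b • ·) (h X)

end FB

/-! ### Bisets and their action on Burnside groups -/

/-- A finite `(H, G)`-biset: a finite set with a left action of `H` and a right action of `G`
that commute. -/
structure FinBiset (H G : Type u) [Group H] [Group G] where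
  carrier : Type u
  [fin : Finite carrier]
  left : H → carrier → carrier
  right : carrier → G → carrier
  one_left : ∀ v, left 1 v = v
  mul_left : ∀ h h' v, left (h * h') v = left h (left h' v)
  right_one : ∀ v, right v 1 = v
  right_mul : ∀ v g g', right v (g * g') = right (right v g) g'
  assoc : ∀ h v g, right (left h v) g = left h (right v g)

attribute [instance] FinBiset.fin

namespace FinBiset

variable {H G : Type u} [Group H] [Group G]

/-- The `(H × K, G × K)`-biset `V × K`, where `K` acts on both sides of the second factor by
multiplication. -/
def prodSelf (V : FinBiset H G) (K : Type u) [Group K] [Finite K] :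
    FinBiset (H × K) (G × K) where
  carrier := V.carrier × K
  left a v := (V.left a.1 v.1, a.2 * v.2)
  right v b := (V.right v.1 b.1, v.2 * b.2)
  one_left v := by simp [V.one_left]
  mul_left a a' v := by simp [V.mul_left, mul_assoc]
  right_one v := by simp [V.right_one]
  right_mul v b b' := by simp [V.right_mul, mul_assoc]
  assoc a v b := by simp [V.assoc, mul_assoc]

/-- The equivalence relation on `V × X` whose classes are the orbits of
`(v, x) · g = (v g, g⁻¹ x)`. -/
def orbitRel (V : FinBiset H G) (X : FinGSet G) : Setoid (V.carrier × X.carrier) where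
  r a b := ∃ g : G, b = (V.right a.1 g, g⁻¹ • a.2)
  iseqv :=
    { refl := fun a => ⟨1, by simp [V.right_one]⟩
      symm := by
        rintro a b ⟨g, rfl⟩
        exact ⟨g⁻¹, by simp [← V.right_mul, V.right_one]⟩
      trans := by
        rintro a b c ⟨g, rfl⟩ ⟨g', rfl⟩
        exact ⟨g * g', by simp [V.right_mul, mul_smul]⟩ }

/-- The finite `H`-set `V ×_G X = (V × X) / G`. -/
def comp (V : FinBiset H G) (X : FinGSet G) : FinGSet H where
  carrier := Quotient (V.orbitRel X)
  act :=
    { smul := fun h => Quotient.map (fun a => (V.left h a.1, a.2)) (by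
        rintro a b ⟨g, rfl⟩
        exact ⟨g, by simp [V.assoc]⟩)
      one_smul := by
        rintro ⟨a⟩
        exact congrArg (Quotient.mk (V.orbitRel X)) (Prod.ext (V.one_left _) rfl)
      mul_smul := by
        rintro h h' ⟨a⟩
        exact congrArg (Quotient.mk (V.orbitRel X)) (Prod.ext (V.mul_left _ _ _) rfl) }

theorem comp_iso (V : FinBiset H G) {X Y : FinGSet G} (h : X.Iso Y) :
    (V.comp X).Iso (V.comp Y) := by
  obtain ⟨e, he⟩ := h
  refine ⟨Quotient.congr ((Equiv.refl _).prodCongr e) ?_, ?_⟩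
  · rintro ⟨v, x⟩ ⟨v', x'⟩
    constructor
    · rintro ⟨g, hg⟩
      rw [Prod.ext_iff] at hg
      exact ⟨g, Prod.ext hg.1 (by simpa [he] using congrArg e hg.2)⟩
    · rintro ⟨g, hg⟩
      rw [Prod.ext_iff] at hg
      exact ⟨g, Prod.ext hg.1 (e.injective (by simpa [he] using hg.2))⟩
  · rintro k ⟨a⟩
    rfl

theorem comp_sum (V : FinBiset H G) (X Y : FinGSet G) :
    (V.comp (X.sum Y)).Iso ((V.comp X).sum (V.comp Y)) := by
  let f : (V.comp (X.sum Y)).carrier → ((V.comp X).sum (V.comp Y)).carrier :=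
    Quotient.lift (fun a : V.carrier × (X.carrier ⊕ Y.carrier) =>
      Sum.map (fun x => (Quotient.mk (V.orbitRel X) (a.1, x)))
        (fun y => (Quotient.mk (V.orbitRel Y) (a.1, y))) a.2) (by
      rintro ⟨v, x | y⟩ b ⟨g, rfl⟩
      · exact congrArg Sum.inl (Quotient.sound ⟨g, rfl⟩)
      · exact congrArg Sum.inr (Quotient.sound ⟨g, rfl⟩))
  let f' : ((V.comp X).sum (V.comp Y)).carrier → (V.comp (X.sum Y)).carrier :=
    Sum.elim
      (Quotient.lift (fun a : V.carrier × X.carrier =>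
        Quotient.mk (V.orbitRel (X.sum Y)) (a.1, Sum.inl a.2)) (by
        rintro a b ⟨g, rfl⟩
        exact Quotient.sound ⟨g, rfl⟩))
      (Quotient.lift (fun a : V.carrier × Y.carrier =>
        Quotient.mk (V.orbitRel (X.sum Y)) (a.1, Sum.inr a.2)) (by
        rintro a b ⟨g, rfl⟩
        exact Quotient.sound ⟨g, rfl⟩))
  refine ⟨⟨f, f', ?_, ?_⟩, ?_⟩
  · rintro ⟨v, x | y⟩ <;> rfl
  · rintro (⟨v, x⟩ | ⟨v, y⟩) <;> rfl
  · rintro k ⟨v, x | y⟩ <;> rfl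

end FinBiset

/-- The linear map `𝔽B(V) : 𝔽B(G) → 𝔽B(H)`, `[X] ↦ [V ×_G X]`, for an `(H, G)`-biset `V`. -/
noncomputable def FB.map (F : Type w) [Field F] {H G : Type u} [Group H] [Group G]
    (V : FinBiset H G) : FB F G →ₗ[F] FB F H :=
  FB.lift F (fun X => FB.mk F (V.comp X)) (fun _ _ h => FB.mk_iso F (V.comp_iso h))
    (fun X Y => (FB.mk_iso F (V.comp_sum X Y)).trans (FB.mk_sum F _ _))

/-! ### The Burnside functor shifted by `K` -/

/-- `𝔽B_K(G) = 𝔽B(G × K)`. -/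
abbrev FBK (F : Type w) [Field F] (K : Type u) [Group K] (G : Type u) [Group G] :
    Type (max (u + 1) w) :=
  FB F (G × K)

/-- `𝔽B_K(V) = 𝔽B(V × K)` for an `(H, G)`-biset `V`. -/
noncomputable def FBK.map (F : Type w) [Field F] (K : Type u) [Group K] [Finite K]
    {H G : Type u} [Group H] [Group G] (V : FinBiset H G) : FBK F K G →ₗ[F] FBK F K H :=
  FB.map F (V.prodSelf K)

/-- The cartesian product of a `(G × K)`-set and an `(H × K)`-set, as a `((G × H) × K)`-set:
the restriction of the `((G × K) × (H × K))`-set `X × Y` along `(g, h, k) ↦ (g, k, h, k)`. -/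
def FinGSet.extProd {K G H : Type u} [Group K] [Group G] [Group H]
    (X : FinGSet (G × K)) (Y : FinGSet (H × K)) : FinGSet ((G × H) × K) where
  carrier := X.carrier × Y.carrier
  act :=
    { smul := fun a z => ((a.1.1, a.2) • z.1, (a.1.2, a.2) • z.2)
      one_smul := fun z => Prod.ext (one_smul (G × K) z.1) (one_smul (H × K) z.2)
      mul_smul := fun a b z => Prod.ext
        (mul_smul ((a.1.1, a.2) : G × K) (b.1.1, b.2) z.1)
        (mul_smul ((a.1.2, a.2) : H × K) (b.1.2, b.2) z.2) }

section ExtProd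

variable {K G H : Type u} [Group K] [Group G] [Group H]

theorem FinGSet.extProd_iso {X X' : FinGSet (G × K)} {Y Y' : FinGSet (H × K)}
    (hX : X.Iso X') (hY : Y.Iso Y') : (X.extProd Y).Iso (X'.extProd Y') := by
  obtain ⟨e, he⟩ := hX
  obtain ⟨f, hf⟩ := hY
  exact ⟨e.prodCongr f, fun a z => Prod.ext (he _ _) (hf _ _)⟩

theorem FinGSet.iso_refl (X : FinGSet G) : X.Iso X := ⟨Equiv.refl _, fun _ _ => rfl⟩

theorem FinGSet.extProd_sum_left (X X' : FinGSet (G × K)) (Y : FinGSet (H × K)) :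
    ((X.sum X').extProd Y).Iso ((X.extProd Y).sum (X'.extProd Y)) := by
  refine ⟨Equiv.sumProdDistrib _ _ _, ?_⟩
  rintro a ⟨x | x, y⟩ <;> rfl

theorem FinGSet.extProd_sum_right (X : FinGSet (G × K)) (Y Y' : FinGSet (H × K)) :
    (X.extProd (Y.sum Y')).Iso ((X.extProd Y).sum (X.extProd Y')) := by
  refine ⟨Equiv.prodSumDistrib _ _ _, ?_⟩
  rintro a ⟨x, y | y⟩ <;> rfl

/-- The bilinear product `𝔽B_K(G) × 𝔽B_K(H) → 𝔽B_K(G × H)` of the Green biset functor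
`𝔽B_K`. -/
noncomputable def FBK.prod (F : Type w) [Field F] :
    FBK F K G →ₗ[F] FBK F K H →ₗ[F] FBK F K (G × H) :=
  FB.lift F
    (fun X => FB.lift F (fun Y => FB.mk F (X.extProd Y))
      (fun _ _ h => FB.mk_iso F (FinGSet.extProd_iso X.iso_refl h))
      (fun Y Y' => (FB.mk_iso F (X.extProd_sum_right Y Y')).trans (FB.mk_sum F _ _)))
    (fun X X' h => FB.hom_ext F fun Y => by
      simpa using FB.mk_iso F (FinGSet.extProd_iso h Y.iso_refl))
    (fun X X' => FB.hom_ext F fun Y => by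
      simpa using (FB.mk_iso F (X.extProd_sum_left X' Y)).trans (FB.mk_sum F _ _))

end ExtProd

/-- An ideal of the commutative Green biset functor `𝔽B_K`: a biset subfunctor `I` such that
`𝔽B_K(G) × I(H) ⊆ I(G × H)`. -/
structure GreenIdeal (F : Type w) [Field F] (K : Type u) [Group K] [Finite K] where
  eval : ∀ (G : Type u) [Group G] [Finite G], Submodule F (FBK F K G)
  map_mem : ∀ {H G : Type u} [Group H] [Finite H] [Group G] [Finite G] (V : FinBiset H G)
    (a : FBK F K G), a ∈ eval G → FBK.map F K V a ∈ eval H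
  prod_mem : ∀ {G H : Type u} [Group G] [Finite G] [Group H] [Finite H] (a : FBK F K G)
    (b : FBK F K H), b ∈ eval H → FBK.prod F a b ∈ eval (G × H)

/-- The ideal of `𝔽B_K` generated by an element `c` of `𝔽B_K(L)`: the intersection of all
ideals that contain it. -/
noncomputable def GreenIdeal.generatedBy {F : Type w} [Field F] {K : Type u} [Group K] [Finite K]
    {L : Type u} [Group L] [Finite L] (c : FBK F K L) : GreenIdeal F K where
  eval G _ _ := ⨅ (I : GreenIdeal F K) (_ : c ∈ I.eval L), I.eval G
  map_mem V a ha := by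
    simp only [Submodule.mem_iInf] at ha ⊢
    exact fun I hI => I.map_mem V a (ha I hI)
  prod_mem a b hb := by
    simp only [Submodule.mem_iInf] at hb ⊢
    exact fun I hI => I.prod_mem a b (hb I hI)

/-! ### Möbius function, idempotents and the numbers `m_{L,N}` -/

open Classical in
/-- The Möbius function of the poset of subgroups of a finite group. -/
noncomputable def subgroupMu {G : Type u} [Group G] [Finite G] (X Y : Subgroup G) : ℤ :=
  letI : Fintype (Subgroup G) := Fintype.ofFinite _
  letI : LocallyFiniteOrder (Subgroup G) := Fintype.toLocallyFiniteOrder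
  IncidenceAlgebra.mu ℤ X Y

/-- The primitive idempotent `e_S^G` of `𝔽B(G)`, by the formula of Gluck and Yoshida. -/
noncomputable def idem (F : Type w) [Field F] {G : Type u} [Group G] [Finite G]
    (S : Subgroup G) : FB F G :=
  (Nat.card (Subgroup.normalizer (S : Set G)) : F)⁻¹ •
    ∑ X ∈ (Set.toFinite {X : Subgroup G | X ≤ S}).toFinset,
      ((Nat.card X : F) * (subgroupMu X S : F)) • FB.mk F (FinGSet.coset X)

/-- `m_{L,N} = (1 / |L|) ∑ |X| μ(X, L)`, the sum being over the subgroups `X` of `L` such that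
`X N = L`. -/
noncomputable def mCoeff {L : Type u} [Group L] [Finite L] (N : Subgroup L) : ℚ :=
  open scoped Pointwise in
  (Nat.card L : ℚ)⁻¹ *
    ∑ X ∈ (Set.toFinite {X : Subgroup L | (X : Set L) * (N : Set L) = Set.univ}).toFinset,
      (Nat.card X : ℚ) * (subgroupMu X ⊤ : ℚ)

/-! ### Groups over `K` -/

section Over

variable {K L L' : Type u} [Group K] [Group L] [Group L']

/-- `f` is a morphism `(L, φ) → (L', φ')` of groups over `K`: there is an inner automorphism `i`
of `K` with `i ∘ φ = φ' ∘ f`. -/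
def IsOverHom (φ : L →* K) (φ' : L' →* K) (f : L →* L') : Prop :=
  ∃ k : K, (MulAut.conj k).toMonoidHom.comp φ = φ'.comp f

/-- `(L, φ)` and `(L', φ')` are isomorphic in the category of groups over `K`. -/
def OverIso (φ : L →* K) (φ' : L' →* K) : Prop :=
  ∃ (f : L →* L') (g : L' →* L), IsOverHom φ φ' f ∧ IsOverHom φ' φ g ∧
    g.comp f = MonoidHom.id L ∧ f.comp g = MonoidHom.id L'

/-- `(L, φ)` is a `B_K`-group. -/
def IsBGroup [Finite L] (φ : L →* K) : Prop :=
  ∀ N : Subgroup L, N.Normal → N ≤ φ.ker → N ≠ ⊥ → mCoeff N = 0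

/-- The ideal `e_{L,φ}` of `𝔽B_K` generated by the idempotent of `𝔽B_K(L)` attached to the
subgroup `{(l, φ(l))}` of `L × K`. -/
noncomputable def idealOf (F : Type w) [Field F] [Finite K] [Finite L] (φ : L →* K) :
    GreenIdeal F K :=
  GreenIdeal.generatedBy (L := L) (idem F φ.graph)

/-- `(L, φ)` is `p`-persistent: `e_{L,φ}(P) ≠ 0` for some finite `p`-group `P`. -/
def IsPersistent (F : Type w) [Field F] (p : ℕ) [Finite K] [Finite L] (φ : L →* K) : Prop :=
  ∃ (P : Type u) (_ : Group P) (_ : Finite P), IsPGroup p P ∧ (idealOf F φ).eval P ≠ ⊥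

end Over

/-! ### `O^p(L)` and conjugacy of subgroups -/

/-- `O^p(L)`: the subgroup of `L` generated by the elements of order prime to `p`. -/
def pResidual (p : ℕ) (L : Type u) [Group L] : Subgroup L :=
  Subgroup.closure {x : L | (orderOf x).Coprime p}

instance (p : ℕ) (L : Type u) [Group L] : (pResidual p L).Normal := by
  refine ⟨fun n hn g => ?_⟩
  suffices h : pResidual p L ≤ (pResidual p L).comap (MulAut.conj g).toMonoidHom from h hn
  refine (Subgroup.closure_le _).2 fun x hx => Subgroup.subset_closure ?_
  have h : orderOf (MulAut.conj g x) = orderOf x := orderOf_injective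
    (MulAut.conj g).toMonoidHom (MulAut.conj g).injective x
  change (orderOf (MulAut.conj g x)).Coprime p
  rw [h]
  exact hx

/-- `L^{[p]} = L / O^p(L)`. -/
abbrev pQuot (p : ℕ) (L : Type u) [Group L] : Type u := L ⧸ pResidual p L

/-- Conjugacy of subgroups. -/
def SubgroupConj {K : Type u} [Group K] (A B : Subgroup K) : Prop :=
  ∃ k : K, A.map (MulAut.conj k).toMonoidHom = B

/-- A set of representatives of the conjugacy classes of subgroups of `K`. -/
def IsSubgroupReps {K : Type u} [Group K] (s : Set (Subgroup K)) : Prop :=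
  ∀ A : Subgroup K, ∃! B : Subgroup K, B ∈ s ∧ SubgroupConj A B

/-- The cyclic group of order `p`. -/
abbrev Cyc (p : ℕ) : Type := Multiplicative (ZMod p)

/-- One and only one of three propositions holds. -/
def ExactlyOne (a b c : Prop) : Prop :=
  (a ∧ ¬ b ∧ ¬ c) ∨ (¬ a ∧ b ∧ ¬ c) ∨ (¬ a ∧ ¬ b ∧ c)

end RelBGroup

/-! The proof has two halves. The first shows that `φ.ker ⊓ pResidual p L = ⊥` for a persistent
`B_K`-group (`ker_inf_pResidual_eq_bot`); the second is pure group theory and classifies the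
`B_K`-groups with this property (`classification_of_ker_inf_pResidual_eq_bot`).

For the first half, fix a `p`-group `P`. Homomorphisms `α`, `β`, `κ` from a finite group `Ω` to `P`,
`G`, `K` give a linear form on `𝔽B_K(G)`: with `N = ker α ∩ ker κ`, it counts the `N`-orbits of a
set that are stable under `Ω`, times `|N|`. The common zeros of all these forms are an ideal
(`vanishingIdeal`). At `G = P` the forms include all marks, so by Burnside's theorem the ideal is
zero there. It remains to see that if `Ker φ ∩ O^p(L)` is non-trivial, the generating idempotent
lies in the ideal. By `countFun_idem_eq_zero` this reduces to `m_{L,M} = 0`, where `M` is the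
preimage in `L` of the image of `N`. Now `M ≤ Ker φ` because `N ≤ ker κ`, and `M` contains `Ker φ ∩
O^p(L)` because elements of `O^p(L)` lift to `Ω` with trivial image in the `p`-group `P`. So `M` is
non-trivial and the `B_K`-condition applies.

For the second half, each non-trivial normal subgroup of `L` inside `Ker φ` contains a central `N`
of order `p`. The equation `m_{L,N} = 0` says exactly that `N` has `p` complements in `L`.
Complements are kernels of homomorphisms `L → C_p` extending a fixed isomorphism on `N`, so such
extensions exist and the group of homomorphisms trivial on `N` has order `p`. This bounds the rank:
at most two factors `C_p` split off, and the same count determines `H^{[p]}`. -/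

namespace RelBGroup

/-! ### Counting stable orbits. -/

section StableCount

variable {Ω : Type*} [Group Ω] {C D : Type*}

open Classical in
/-- The weight of a point `c`: the order of its stabilizer in `N` if the `N`-orbit of `c` is
stable under the whole group, and zero otherwise. -/
noncomputable def stableWeight (N : Subgroup Ω) (ρ : Ω →* Equiv.Perm C) (c : C) : ℕ :=
  if ∀ ω, ∃ n ∈ N, ρ ω c = ρ n c then Nat.card {n : Ω // n ∈ N ∧ ρ n c = c} else 0

/-- The number of stable `N`-orbits, multiplied by the order of `N`. -/
noncomputable def stableCount (N : Subgroup Ω) (ρ : Ω →* Equiv.Perm C) : ℕ :=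
  ∑ᶠ c, stableWeight N ρ c

theorem stableWeight_map (N : Subgroup Ω) {ρ : Ω →* Equiv.Perm C} {σ : Ω →* Equiv.Perm D}
    {j : C → D} (hj : Function.Injective j) (h : ∀ ω c, σ ω (j c) = j (ρ ω c)) (c : C) :
    stableWeight N σ (j c) = stableWeight N ρ c := by
  classical
  have key : (∀ ω, ∃ n ∈ N, σ ω (j c) = σ n (j c)) ↔ ∀ ω, ∃ n ∈ N, ρ ω c = ρ n c := by
    simp only [h, hj.eq_iff]
  rw [stableWeight, stableWeight, if_congr key rfl rfl]
  simp only [h, hj.eq_iff]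

theorem stableCount_congr (N : Subgroup Ω) {ρ : Ω →* Equiv.Perm C} {σ : Ω →* Equiv.Perm D}
    (e : C ≃ D) (h : ∀ ω c, σ ω (e c) = e (ρ ω c)) : stableCount N ρ = stableCount N σ := by
  rw [stableCount, stableCount, ← finsum_comp_equiv e]
  exact finsum_congr fun c => (stableWeight_map N e.injective h c).symm

theorem stableCount_sum [Finite C] [Finite D] (N : Subgroup Ω) {ρ : Ω →* Equiv.Perm C}
    {σ : Ω →* Equiv.Perm D} {τ : Ω →* Equiv.Perm (C ⊕ D)}
    (hl : ∀ ω c, τ ω (Sum.inl c) = Sum.inl (ρ ω c))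
    (hr : ∀ ω d, τ ω (Sum.inr d) = Sum.inr (σ ω d)) :
    stableCount N τ = stableCount N ρ + stableCount N σ := by
  have := Fintype.ofFinite C
  have := Fintype.ofFinite D
  simp only [stableCount, finsum_eq_sum_of_fintype, Fintype.sum_sum_type,
    stableWeight_map N Sum.inl_injective hl, stableWeight_map N Sum.inr_injective hr]

/-- The stabilizer of a point for a permutation representation. -/
def permStabilizer (ρ : Ω →* Equiv.Perm C) (c : C) : Subgroup Ω :=
  (MulAction.stabilizer (Equiv.Perm C) c).comap ρ

-- If the `N`-orbit of `c` is stable, every `ω` can be corrected by an element of `N` so as to fix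
-- `c`. Stability of the orbit of `(c, d)` then becomes stability of the orbit of `d`, for the
-- stabilizer of `c` and its intersection with `N`.
open Classical in
theorem stableWeight_prod (N : Subgroup Ω) {ρ : Ω →* Equiv.Perm C} {σ : Ω →* Equiv.Perm D}
    {τ : Ω →* Equiv.Perm (C × D)} (h : ∀ ω c d, τ ω (c, d) = (ρ ω c, σ ω d)) (c : C) (d : D) :
    stableWeight N τ (c, d) =
      if ∀ ω, ∃ n ∈ N, ρ ω c = ρ n c then
        stableWeight (N.subgroupOf (permStabilizer ρ c))
          (σ.comp (permStabilizer ρ c).subtype) d else 0 := by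
  have key : (∀ ω, ∃ n ∈ N, τ ω (c, d) = τ n (c, d)) ↔ (∀ ω, ∃ n ∈ N, ρ ω c = ρ n c) ∧
      ∀ ω : permStabilizer ρ c, ∃ n ∈ N.subgroupOf (permStabilizer ρ c), σ ω d = σ n d := by
    simp only [h, Prod.mk.injEq]
    constructor
    · intro H
      refine ⟨fun ω => ?_, fun ω => ?_⟩
      · obtain ⟨n, hn, h1, -⟩ := H ω
        exact ⟨n, hn, h1⟩
      · obtain ⟨n, hn, h1, h2⟩ := H ω
        exact ⟨⟨n, h1.symm.trans ω.2⟩, hn, h2⟩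
    · rintro ⟨H1, H2⟩ ω
      obtain ⟨n, hn, h1⟩ := H1 ω
      have hst : ρ (n⁻¹ * ω) c = c := by simp [map_mul, map_inv, h1]
      obtain ⟨m, hm, h2⟩ := H2 ⟨n⁻¹ * ω, hst⟩
      refine ⟨n * m, N.mul_mem hn hm, ?_, ?_⟩
      · have : ρ (m : Ω) c = c := m.2
        simp [map_mul, h1, this]
      · simp only [map_mul, map_inv, Equiv.Perm.mul_apply] at h2 ⊢
        exact (Equiv.Perm.inv_eq_iff_eq.1 h2).trans rfl
  unfold stableWeight
  rw [if_congr key rfl rfl, ite_and]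
  refine if_congr Iff.rfl (if_congr Iff.rfl ?_ rfl) rfl
  refine Nat.card_congr ⟨fun n => ⟨⟨n.1, ?_⟩, n.2.1, ?_⟩, fun n => ⟨n.1, n.2.1, ?_⟩, ?_, ?_⟩
  · exact (Prod.ext_iff.1 ((h n.1 c d).symm.trans n.2.2)).1
  · exact (Prod.ext_iff.1 ((h n.1 c d).symm.trans n.2.2)).2
  · exact (h _ c d).trans (Prod.ext n.1.2 n.2.2)
  · intro n; rfl
  · intro n; rfl

open Classical in
theorem stableCount_prod [Fintype C] [Finite D] (N : Subgroup Ω) {ρ : Ω →* Equiv.Perm C}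
    {σ : Ω →* Equiv.Perm D} {τ : Ω →* Equiv.Perm (C × D)}
    (h : ∀ ω c d, τ ω (c, d) = (ρ ω c, σ ω d)) :
    stableCount N τ = ∑ c, if ∀ ω, ∃ n ∈ N, ρ ω c = ρ n c then
        stableCount (N.subgroupOf (permStabilizer ρ c))
          (σ.comp (permStabilizer ρ c).subtype) else 0 := by
  have := Fintype.ofFinite D
  simp only [stableCount, finsum_eq_sum_of_fintype, Fintype.sum_prod_type,
    stableWeight_prod N h]
  refine Finset.sum_congr rfl fun c _ => ?_
  split_ifs <;> simp

/-- The fibres of `f` are the orbits of the factor `G`, so stable `N`-orbits on `D` match stable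
orbits of `N × G` on `C`; the factor `|G|` comes from weighting an orbit by the order of the acting
group. No freeness of `G` is needed. -/
theorem stableCount_quotient [Finite Ω] {G : Type*} [Group G] [Finite G] [Finite C]
    (N : Subgroup Ω)
    {ρ : Ω × G →* Equiv.Perm C} {σ : Ω →* Equiv.Perm D} {f : C → D}
    (hf : Function.Surjective f) (hσ : ∀ a c, f (ρ a c) = σ a.1 (f c))
    (hG : ∀ c c', f c = f c' → ∃ g, ρ (1, g) c = c') :
    stableCount (N.prod ⊤) ρ = Nat.card G * stableCount N σ := by
  classical
  have := Fintype.ofFinite C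
  have : Finite D := Finite.of_surjective f hf
  have := Fintype.ofFinite D
  have := Fintype.ofFinite G
  have key : ∀ c, (∀ ω, ∃ n ∈ N.prod ⊤, ρ ω c = ρ n c) ↔
      ∀ ω, ∃ n ∈ N, σ ω (f c) = σ n (f c) := by
    intro c
    constructor
    · intro H ω
      obtain ⟨n, hn, h⟩ := H (ω, 1)
      exact ⟨n.1, hn.1, by simpa [hσ] using congrArg f h⟩
    · rintro H ⟨ω, g⟩
      obtain ⟨n, hn, h⟩ := H ω
      obtain ⟨g', hg'⟩ := hG (ρ (n, 1) c) (ρ (ω, g) c) (by simp [hσ, h])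
      refine ⟨(n, g'), ⟨hn, trivial⟩, ?_⟩
      rw [← hg', ← Equiv.Perm.mul_apply, ← map_mul]
      simp
  -- The stabilizer of `c` in `N × G` fibres over the stabilizer of `f c₀` in `N`, each fibre being
  -- a translate of the set of `h` carrying `c₀` to `c`. These sets partition `G` when `c` runs
  -- through a fibre of `f`.
  have card : ∀ c c₀, f c = f c₀ → Nat.card {n : Ω × G // n ∈ N.prod ⊤ ∧ ρ n c = c} =
      Nat.card {n : Ω // n ∈ N ∧ σ n (f c₀) = f c₀} * Nat.card {h : G // ρ (1, h) c₀ = c} := by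
    intro c c₀ hc
    have t : ∀ n : {n : Ω // n ∈ N ∧ σ n (f c₀) = f c₀}, ∃ g, ρ (1, g) c₀ = ρ (n.1, 1) c :=
      fun n => hG _ _ (by rw [hσ, hc, n.2.2])
    choose t ht using t
    rw [← Nat.card_prod]
    refine Nat.card_congr ⟨fun n => ⟨⟨n.1.1, n.2.1.1, ?_⟩, ⟨n.1.2 * t ⟨n.1.1, n.2.1.1, ?_⟩, ?_⟩⟩,
      fun m => ⟨(m.1.1, m.2.1 * (t m.1)⁻¹), ⟨m.1.2.1, trivial⟩, ?_⟩, ?_, ?_⟩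
    · rw [← hc, ← hσ n.1 c, n.2.2]
    · rw [← hc, ← hσ n.1 c, n.2.2]
    · have e : ((1, n.1.2 * t ⟨n.1.1, n.2.1.1, by rw [← hc, ← hσ n.1 c, n.2.2]⟩) : Ω × G) =
        (1, n.1.2) * (1, t ⟨n.1.1, n.2.1.1, by rw [← hc, ← hσ n.1 c, n.2.2]⟩) := by simp
      rw [e, map_mul, Equiv.Perm.mul_apply, ht, ← Equiv.Perm.mul_apply, ← map_mul]
      simpa using n.2.2
    · have e : ((m.1.1, m.2.1 * (t m.1)⁻¹) : Ω × G) =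
        (1, m.2.1) * (1, t m.1)⁻¹ * (m.1.1, 1) := by simp
      rw [e, map_mul, Equiv.Perm.mul_apply, ← ht, map_mul, Equiv.Perm.mul_apply, map_inv]
      simpa using m.2.2
    · intro n
      ext <;> simp
    · intro m
      ext <;> simp
  have fib : ∀ d, ∑ c with f c = d, stableWeight (N.prod ⊤) ρ c =
      Nat.card G * stableWeight N σ d := by
    intro d
    obtain ⟨c₀, rfl⟩ := hf d
    have h1 : ∀ c ∈ Finset.univ.filter (fun c => f c = f c₀), stableWeight (N.prod ⊤) ρ c =
        stableWeight N σ (f c₀) * Nat.card {h : G // ρ (1, h) c₀ = c} := by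
      intro c hc
      have hc := (Finset.mem_filter.1 hc).2
      rw [stableWeight, stableWeight, if_congr (key c) rfl rfl, hc, card c c₀ hc, ite_mul, zero_mul]
    rw [Finset.sum_congr rfl h1, ← Finset.mul_sum, mul_comm]
    congr 1
    rw [Nat.card_eq_fintype_card, ← Finset.card_univ,
      Finset.card_eq_sum_card_fiberwise (f := fun h => ρ (1, h) c₀)
        (t := Finset.univ.filter (fun c => f c = f c₀))]
    · refine Finset.sum_congr rfl fun c _ => ?_
      rw [Nat.card_eq_fintype_card, Fintype.card_subtype]
    · intro h _
      simp [hσ]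
  rw [stableCount, stableCount, finsum_eq_sum_of_fintype, finsum_eq_sum_of_fintype,
    Finset.mul_sum, ← Finset.sum_fiberwise_of_maps_to (s := Finset.univ) (t := Finset.univ)
      (g := f) (fun _ _ => Finset.mem_univ _)]
  exact Finset.sum_congr rfl fun d _ => fib d

end StableCount

/-! ### The counts as linear forms, under bisets and products. -/

section CountFun

variable (F : Type w) [Field F]

/-- The permutation representation of `Ω` on a `G`-set, by restriction along `θ : Ω → G`. -/
def FinGSet.perm {Ω : Type*} [Group Ω] {G : Type u} [Group G] (θ : Ω →* G) (X : FinGSet G) :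
    Ω →* Equiv.Perm X.carrier :=
  (MulAction.toPermHom G X.carrier).comp θ

theorem FinGSet.perm_apply {Ω : Type*} [Group Ω] {G : Type u} [Group G] (θ : Ω →* G)
    (X : FinGSet G) (ω : Ω) (x : X.carrier) : X.perm θ ω x = θ ω • x := rfl

/-- The linear form on `𝔽B(G)` that extends `stableCount`. -/
noncomputable def countFun {Ω : Type*} [Group Ω] (N : Subgroup Ω) {G : Type u} [Group G]
    (θ : Ω →* G) : FB F G →ₗ[F] F :=
  FB.lift F (fun X => (stableCount N (X.perm θ) : F))
    (by
      rintro X Y ⟨e, he⟩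
      rw [stableCount_congr N (ρ := X.perm θ) (σ := Y.perm θ) e fun ω c => (he (θ ω) c).symm])
    (by
      intro X Y
      rw [← Nat.cast_add]
      exact congrArg _ (stableCount_sum N (fun _ _ => rfl) (fun _ _ => rfl)))

theorem countFun_mk {Ω : Type*} [Group Ω] (N : Subgroup Ω) {G : Type u} [Group G]
    (θ : Ω →* G) (X : FinGSet G) :
    countFun F N θ (FB.mk F X) = (stableCount N (X.perm θ) : F) :=
  FB.lift_mk _ _ _ _ _

/-- The permutation representation of `H × G` on an `(H, G)`-biset. -/
def FinBiset.perm {H G : Type u} [Group H] [Group G] (V : FinBiset H G) :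
    H × G →* Equiv.Perm V.carrier :=
  MonoidHom.toHomPerm
    { toFun := fun a v => V.left a.1 (V.right v a.2⁻¹)
      map_one' := by
        funext v
        change _ = v
        simp [V.one_left, V.right_one]
      map_mul' := fun a b => by
        funext v
        change _ = V.left a.1 (V.right (V.left b.1 (V.right v b.2⁻¹)) a.2⁻¹)
        simp [V.mul_left, V.right_mul, V.assoc] }

theorem FinBiset.perm_apply {H G : Type u} [Group H] [Group G] (V : FinBiset H G) (a : H × G)
    (v : V.carrier) : V.perm a v = V.left a.1 (V.right v a.2⁻¹) := rfl

-- Pass from `V ×_G X` up to `V × X` by `stableCount_quotient`, then fibre `V × X` over `V` by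
-- `stableCount_prod`. Each term is again a count on `X`, now for the stabilizer of `v`, so
-- vanishing of all such forms is inherited.
open Classical in
theorem stableCount_comp {Ω : Type*} [Group Ω] [Finite Ω] (N : Subgroup Ω) {H G : Type u}
    [Group H] [Group G] [Finite G] (θ : Ω →* H) (V : FinBiset H G) [Fintype V.carrier]
    (X : FinGSet G) :
    Nat.card G * stableCount N ((V.comp X).perm θ) =
      ∑ v : V.carrier, if ∀ ω : Ω × G, ∃ n ∈ N.prod ⊤,
          V.perm.comp (θ.prodMap (MonoidHom.id G)) ω v =
            V.perm.comp (θ.prodMap (MonoidHom.id G)) n v then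
        stableCount ((N.prod ⊤).subgroupOf
          (permStabilizer (V.perm.comp (θ.prodMap (MonoidHom.id G))) v))
          (X.perm ((MonoidHom.snd Ω G).comp
            (permStabilizer (V.perm.comp (θ.prodMap (MonoidHom.id G))) v).subtype)) else 0 := by
  let τ : Ω × G →* Equiv.Perm (V.carrier × X.carrier) :=
    MonoidHom.toHomPerm
      { toFun := fun a z => (V.perm (θ a.1, a.2) z.1, a.2 • z.2)
        map_one' := by
          funext z
          change _ = z
          simp [FinBiset.perm_apply, V.one_left, V.right_one]
        map_mul' := fun a b => by
          funext z
          change _ = (V.perm (θ a.1, a.2) (V.perm (θ b.1, b.2) z.1), a.2 • b.2 • z.2)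
          have : ((θ (a * b).1, (a * b).2) : H × G) = (θ a.1, a.2) * (θ b.1, b.2) := by simp
          simp only [this, map_mul]
          simp [mul_smul] }
  have hτ : ∀ a z, τ a z = (V.perm (θ a.1, a.2) z.1, a.2 • z.2) := fun _ _ => rfl
  have h1 := stableCount_quotient N (ρ := τ) (σ := (V.comp X).perm θ)
    (f := Quotient.mk (V.orbitRel X)) Quotient.mk_surjective
    (by
      rintro ⟨ω, g⟩ ⟨v, x⟩
      change Quotient.mk (V.orbitRel X) _ = Quotient.mk (V.orbitRel X) (V.left (θ ω) v, x)
      refine Quotient.sound ⟨g, ?_⟩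
      simp [hτ, FinBiset.perm_apply, V.assoc, ← V.right_mul, V.right_one])
    (by
      rintro c c' h
      obtain ⟨g, rfl⟩ := Quotient.exact h
      exact ⟨g⁻¹, by simp [hτ, FinBiset.perm_apply, V.one_left]⟩)
  rw [← h1, stableCount_prod (N.prod ⊤) (ρ := V.perm.comp (θ.prodMap (MonoidHom.id G)))
    (σ := X.perm (MonoidHom.snd Ω G)) (fun ω c d => rfl)]
  rfl

open Classical in
theorem countFun_map {Ω : Type*} [Group Ω] [Finite Ω] (N : Subgroup Ω) {H G : Type u}
    [Group H] [Group G] [Finite G] (θ : Ω →* H) (V : FinBiset H G) [Fintype V.carrier]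
    (a : FB F G) :
    (Nat.card G : F) * countFun F N θ (FB.map F V a) =
      ∑ v : V.carrier, if ∀ ω : Ω × G, ∃ n ∈ N.prod ⊤,
          V.perm.comp (θ.prodMap (MonoidHom.id G)) ω v =
            V.perm.comp (θ.prodMap (MonoidHom.id G)) n v then
        countFun F ((N.prod ⊤).subgroupOf
          (permStabilizer (V.perm.comp (θ.prodMap (MonoidHom.id G))) v))
          ((MonoidHom.snd Ω G).comp
            (permStabilizer (V.perm.comp (θ.prodMap (MonoidHom.id G))) v).subtype) a else 0 := by
  have h := FB.hom_ext F (f := (Nat.card G : F) • (countFun F N θ ∘ₗ FB.map F V))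
    (g := ∑ v : V.carrier, if ∀ ω : Ω × G, ∃ n ∈ N.prod ⊤,
          V.perm.comp (θ.prodMap (MonoidHom.id G)) ω v =
            V.perm.comp (θ.prodMap (MonoidHom.id G)) n v then
        countFun F ((N.prod ⊤).subgroupOf
          (permStabilizer (V.perm.comp (θ.prodMap (MonoidHom.id G))) v))
          ((MonoidHom.snd Ω G).comp
            (permStabilizer (V.perm.comp (θ.prodMap (MonoidHom.id G))) v).subtype) else 0)
    (fun X => by
      have := congrArg (Nat.cast : ℕ → F) (stableCount_comp N θ V X)
      rw [Nat.cast_mul, Nat.cast_sum] at this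
      rw [LinearMap.smul_apply, LinearMap.comp_apply, FB.map, FB.lift_mk, countFun_mk,
        smul_eq_mul, this, LinearMap.sum_apply]
      refine Finset.sum_congr rfl fun v _ => ?_
      split_ifs
      · rw [countFun_mk]
      · simp)
  have h' := LinearMap.congr_fun h a
  rw [LinearMap.smul_apply, LinearMap.comp_apply, smul_eq_mul, LinearMap.sum_apply] at h'
  rw [h']
  refine Finset.sum_congr rfl fun v _ => ?_
  split_ifs <;> rfl

open Classical in
theorem countFun_prod {Ω : Type*} [Group Ω] (N : Subgroup Ω) {K G H : Type u}
    [Group K] [Group H] [Group G] (β : Ω →* G) (γ : Ω →* H) (κ : Ω →* K) (X : FinGSet (G × K))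
    [Fintype X.carrier] (b : FBK F K H) :
    countFun F N ((β.prod γ).prod κ) (FBK.prod F (FB.mk F X) b) =
      ∑ x : X.carrier, if ∀ ω, ∃ n ∈ N, X.perm (β.prod κ) ω x = X.perm (β.prod κ) n x then
        countFun F (N.subgroupOf (permStabilizer (X.perm (β.prod κ)) x))
          ((γ.prod κ).comp (permStabilizer (X.perm (β.prod κ)) x).subtype) b else 0 := by
  have h := FB.hom_ext F
    (f := countFun F N ((β.prod γ).prod κ) ∘ₗ FBK.prod F (FB.mk F X))
    (g := ∑ x : X.carrier, if ∀ ω, ∃ n ∈ N, X.perm (β.prod κ) ω x = X.perm (β.prod κ) n x then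
        countFun F (N.subgroupOf (permStabilizer (X.perm (β.prod κ)) x))
          ((γ.prod κ).comp (permStabilizer (X.perm (β.prod κ)) x).subtype) else 0)
    (fun Y => by
      have := congrArg (Nat.cast : ℕ → F) (stableCount_prod N (ρ := X.perm (β.prod κ))
        (σ := Y.perm (γ.prod κ)) (τ := (X.extProd Y).perm ((β.prod γ).prod κ))
        (fun _ _ _ => rfl))
      rw [Nat.cast_sum] at this
      rw [LinearMap.comp_apply, FBK.prod, FB.lift_mk, FB.lift_mk, countFun_mk,
        LinearMap.sum_apply]
      refine this.trans ?_
      refine Finset.sum_congr rfl fun v _ => ?_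
      split_ifs
      · rw [countFun_mk]
        rfl
      · simp)
  have h' := LinearMap.congr_fun h b
  rw [LinearMap.comp_apply, LinearMap.sum_apply] at h'
  rw [h']
  refine Finset.sum_congr rfl fun v _ => ?_
  split_ifs <;> rfl

end CountFun

/-! ### The ideal cut out by the counts. -/

section VanishingIdeal

variable (F : Type w) [Field F] (K : Type u) [Group K] (P : Type u) [Group P]

/-- The elements of `𝔽B_K(G)` on which all the forms `countFun` vanish that are attached to
homomorphisms from a finite group to `P`, `G` and `K`. -/
noncomputable def vanishingSubmodule (G : Type u) [Group G] : Submodule F (FBK F K G) :=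
  ⨅ (Ω : Type u) (_ : Group Ω) (_ : Finite Ω) (α : Ω →* P) (β : Ω →* G) (κ : Ω →* K),
    LinearMap.ker (countFun F (α.ker ⊓ κ.ker) (β.prod κ))

variable {F K P}

theorem mem_vanishingSubmodule {G : Type u} [Group G] {a : FBK F K G} :
    a ∈ vanishingSubmodule F K P G ↔ ∀ (Ω : Type u) (_ : Group Ω) (_ : Finite Ω) (α : Ω →* P)
      (β : Ω →* G) (κ : Ω →* K), countFun F (α.ker ⊓ κ.ker) (β.prod κ) a = 0 := by
  simp only [vanishingSubmodule, Submodule.mem_iInf, LinearMap.mem_ker]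

variable (F K P)

/-- The family `vanishingSubmodule` is an ideal of `𝔽B_K`. -/
noncomputable def vanishingIdeal [CharZero F] [Finite K] : GreenIdeal F K where
  eval G _ _ := vanishingSubmodule F K P G
  map_mem {H G} _ _ _ _ V a ha := by
    classical
    refine mem_vanishingSubmodule.2 fun Ω _ _ α β κ => ?_
    have := Fintype.ofFinite (V.prodSelf K).carrier
    have h := countFun_map F (α.ker ⊓ κ.ker) (β.prod κ) (V.prodSelf K) a
    rw [Finset.sum_eq_zero] at h
    · exact (mul_eq_zero.1 h).resolve_left (Nat.cast_ne_zero.2 Nat.card_pos.ne')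
    intro v _
    rw [ite_eq_right_iff]
    intro _
    set S := permStabilizer ((V.prodSelf K).perm.comp
      ((β.prod κ).prodMap (MonoidHom.id (G × K)))) v
    -- On the stabilizer of a point, `κ ω` and the `K`-coordinate `k` are conjugate, since `K` acts
    -- by translation on both sides of the second factor. Hence one is trivial exactly when the
    -- other is, and the new subgroup again has the form `ker α ∩ ker κ`, with `k` in the role of
    -- `κ`.
    have hN : ((α.ker ⊓ κ.ker).prod ⊤).subgroupOf S =
        ((α.comp (MonoidHom.fst Ω (G × K))).comp S.subtype).ker ⊓
          (((MonoidHom.snd G K).comp (MonoidHom.snd Ω (G × K))).comp S.subtype).ker := by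
      ext ⟨⟨ω, g, k⟩, hω⟩
      have h2 : κ ω * (v.2 * k⁻¹) = v.2 := congrArg Prod.snd hω
      have h3 : κ ω = 1 ↔ k = 1 := by
        constructor
        · rintro h
          simpa [h] using h2
        · rintro h
          simpa [h] using h2
      simp [Subgroup.mem_subgroupOf, Subgroup.mem_prod, MonoidHom.mem_ker, h3]
    rw [hN]
    exact mem_vanishingSubmodule.1 ha S inferInstance inferInstance
      ((α.comp (MonoidHom.fst Ω (G × K))).comp S.subtype)
      (((MonoidHom.fst G K).comp (MonoidHom.snd Ω (G × K))).comp S.subtype)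
      (((MonoidHom.snd G K).comp (MonoidHom.snd Ω (G × K))).comp S.subtype)
  prod_mem {G H} _ _ _ _ a b hb := by
    classical
    refine mem_vanishingSubmodule.2 fun Ω _ _ α β κ => ?_
    suffices h : countFun F (α.ker ⊓ κ.ker) (β.prod κ) ∘ₗ (FBK.prod F).flip b = 0 from
      LinearMap.congr_fun h a
    refine FB.hom_ext F fun X => ?_
    have := Fintype.ofFinite X.carrier
    have h := countFun_prod F (α.ker ⊓ κ.ker) ((MonoidHom.fst G H).comp β)
      ((MonoidHom.snd G H).comp β) κ X b
    rw [Finset.sum_eq_zero] at h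
    · exact h
    intro x _
    rw [ite_eq_right_iff]
    intro _
    exact mem_vanishingSubmodule.1 hb _ inferInstance inferInstance
      (α.comp (Subgroup.subtype _)) (((MonoidHom.snd G H).comp β).comp (Subgroup.subtype _))
      (κ.comp (Subgroup.subtype _))

end VanishingIdeal

/-! ### Stabilizers, marks and Burnside's theorem. -/

section Marks

variable (F : Type w) [Field F] {G : Type u} [Group G]

/-- The linear map on the Burnside group that sends `[X]` to the sum, over the points of `X`, of a
function of the stabilizers. -/
noncomputable def stabSum {M : Type*} [AddCommGroup M] [Module F M] (h : Subgroup G → M) :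
    FB F G →ₗ[F] M :=
  FB.lift F (fun X => ∑ᶠ x : X.carrier, h (MulAction.stabilizer G x))
    (by
      rintro X Y ⟨e, he⟩
      rw [← finsum_comp_equiv e]
      refine finsum_congr fun x => congrArg h ?_
      ext g
      rw [MulAction.mem_stabilizer_iff, MulAction.mem_stabilizer_iff, ← he, e.injective.eq_iff])
    (by
      intro X Y
      have := Fintype.ofFinite X.carrier
      have := Fintype.ofFinite Y.carrier
      let : Fintype (X.sum Y).carrier := inferInstanceAs (Fintype (X.carrier ⊕ Y.carrier))
      rw [finsum_eq_sum_of_fintype, finsum_eq_sum_of_fintype, finsum_eq_sum_of_fintype]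
      refine (Fintype.sum_sum_type fun x : X.carrier ⊕ Y.carrier =>
        h (MulAction.stabilizer G (α := (X.sum Y).carrier) x)).trans ?_
      congr 1
      · refine Finset.sum_congr rfl fun x _ => congrArg h ?_
        ext g
        exact Sum.inl_injective.eq_iff
      · refine Finset.sum_congr rfl fun x _ => congrArg h ?_
        ext g
        exact Sum.inr_injective.eq_iff)

theorem stabSum_mk {M : Type*} [AddCommGroup M] [Module F M] (h : Subgroup G → M)
    (X : FinGSet G) :
    stabSum F h (FB.mk F X) = ∑ᶠ x : X.carrier, h (MulAction.stabilizer G x) :=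
  FB.lift_mk _ _ _ _ _

open Classical in
theorem stabSum_eq [Finite G] [Fintype (Subgroup G)] {M : Type*} [AddCommGroup M] [Module F M]
    (h : Subgroup G → M) (a : FB F G) :
    stabSum F h a = ∑ S, stabSum F (fun T => if T = S then (1 : F) else 0) a • h S := by
  have := FB.hom_ext F (f := stabSum F h) (g := ∑ S : Subgroup G, LinearMap.smulRight
    (stabSum F (fun T => if T = S then (1 : F) else 0)) (h S)) (fun X => by
      have := Fintype.ofFinite X.carrier
      simp only [LinearMap.sum_apply, LinearMap.smulRight_apply, stabSum_mk,
        finsum_eq_sum_of_fintype, Finset.sum_smul]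
      rw [Finset.sum_comm]
      simp)
  simpa using LinearMap.congr_fun this a

/-- An invariant subset of a finite `G`-set. -/
def FinGSet.sub (X : FinGSet G) (s : Set X.carrier) (hs : ∀ (g : G), ∀ x ∈ s, g • x ∈ s) :
    FinGSet G where
  carrier := s
  act :=
    { smul := fun g x => ⟨g • x.1, hs g x.1 x.2⟩
      one_smul := fun x => Subtype.ext (one_smul G x.1)
      mul_smul := fun g g' x => Subtype.ext (mul_smul g g' x.1) }

theorem FinGSet.iso_sub_sum (X : FinGSet G) (s : Set X.carrier)
    (hs : ∀ (g : G), ∀ x ∈ s, g • x ∈ s) (hs' : ∀ (g : G), ∀ x ∈ sᶜ, g • x ∈ sᶜ) :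
    ((X.sub s hs).sum (X.sub sᶜ hs')).Iso X := by
  classical
  refine ⟨Equiv.Set.sumCompl s, ?_⟩
  rintro g (x | x) <;> rfl

theorem FB.mk_eq_zero_of_isEmpty (X : FinGSet G) [IsEmpty X.carrier] : FB.mk F X = 0 := by
  have h : (X.sum X).Iso X := ⟨Equiv.sumEmpty X.carrier X.carrier, fun _ x =>
    isEmptyElim (Equiv.sumEmpty X.carrier X.carrier x)⟩
  have := FB.mk_iso F h
  rw [FB.mk_sum] at this
  simpa using this

theorem FinGSet.coset_stabilizer_iso [Finite G] (X : FinGSet G) (x : X.carrier)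
    (s : Set X.carrier) (hs : ∀ (g : G), ∀ y ∈ s, g • y ∈ s) (h : s = MulAction.orbit G x) :
    (FinGSet.coset (MulAction.stabilizer G x)).Iso (X.sub s hs) := by
  subst h
  refine ⟨(MulAction.orbitEquivQuotientStabilizer G x).symm, ?_⟩
  rintro g ⟨a⟩
  refine Subtype.ext ?_
  change ((MulAction.orbitEquivQuotientStabilizer G x).symm
    ((g * a : G) : G ⧸ MulAction.stabilizer G x)).1 =
      g • ((MulAction.orbitEquivQuotientStabilizer G x).symm
        ((a : G) : G ⧸ MulAction.stabilizer G x)).1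
  simp only [MulAction.orbitEquivQuotientStabilizer_symm_apply, mul_smul]

variable [CharZero F]

/-- An orbit is `G / Gₓ` and has `|G| / |Gₓ|` points, so each point carries the inverse of its
orbit's size. The induction removes one orbit at a time. -/
theorem FB.mk_eq_finsum_coset [Finite G] (X : FinGSet G) :
    ∑ᶠ x : X.carrier, ((Nat.card (MulAction.stabilizer G x) : F) * (Nat.card G : F)⁻¹) •
      FB.mk F (FinGSet.coset (MulAction.stabilizer G x)) = FB.mk F X := by
  set h : Subgroup G → FB F G := fun S => ((Nat.card S : F) * (Nat.card G : F)⁻¹) •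
    FB.mk F (FinGSet.coset S) with hh
  change ∑ᶠ x : X.carrier, h (MulAction.stabilizer G x) = _
  rw [← stabSum_mk F h]
  induction hn : Nat.card X.carrier using Nat.strong_induction_on generalizing X with
  | _ n ih =>
  rcases isEmpty_or_nonempty X.carrier with hX | ⟨⟨x⟩⟩
  · rw [FB.mk_eq_zero_of_isEmpty, map_zero]
  set s := MulAction.orbit G x with hs
  have h1 : ∀ (g : G), ∀ y ∈ s, g • y ∈ s := by
    rintro g _ ⟨k, rfl⟩
    exact ⟨g * k, mul_smul g k x⟩
  have h2 : ∀ (g : G), ∀ y ∈ sᶜ, g • y ∈ sᶜ := fun g y hy hy' =>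
    hy (by simpa using h1 g⁻¹ _ hy')
  rw [← FB.mk_iso F (X.iso_sub_sum s h1 h2), FB.mk_sum, map_add]
  congr 1
  · have := Fintype.ofFinite (X.sub s h1).carrier
    rw [stabSum_mk, finsum_eq_sum_of_fintype]
    have key : ∀ y : (X.sub s h1).carrier, h (MulAction.stabilizer G y) =
        ((Nat.card (X.sub s h1).carrier : F)⁻¹) • FB.mk F (X.sub s h1) := by
      intro y
      have e1 : MulAction.stabilizer G y = MulAction.stabilizer G (y.1 : X.carrier) := by
        ext g
        exact Subtype.ext_iff
      have e2 : s = MulAction.orbit G (y.1 : X.carrier) :=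
        (MulAction.orbit_eq_iff.2 y.2).symm
      have e3 := FinGSet.coset_stabilizer_iso X y.1 s h1 e2
      rw [hh, e1]
      change (_ * _) • FB.mk F (FinGSet.coset _) = _
      rw [FB.mk_iso F e3]
      congr 1
      have e4 : Nat.card (X.sub s h1).carrier * Nat.card (MulAction.stabilizer G y.1) =
          Nat.card G := by
        obtain ⟨e, -⟩ := e3
        rw [← Nat.card_congr e]
        exact (Subgroup.card_eq_card_quotient_mul_card_subgroup _).symm
      have e5 : (Nat.card (MulAction.stabilizer G y.1) : F) ≠ 0 :=
        Nat.cast_ne_zero.2 Nat.card_pos.ne'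
      rw [← e4, Nat.cast_mul, mul_inv, mul_comm, mul_assoc, inv_mul_cancel₀ e5, mul_one]
    have : Nonempty (X.sub s h1).carrier := ⟨⟨x, MulAction.mem_orbit_self x⟩⟩
    rw [Finset.sum_congr rfl fun y _ => key y, Finset.sum_const, Finset.card_univ,
      ← Nat.card_eq_fintype_card, ← Nat.cast_smul_eq_nsmul F, smul_smul,
      mul_inv_cancel₀ (Nat.cast_ne_zero.2 Nat.card_pos.ne'), one_smul]
  · refine ih _ ?_ _ rfl
    rw [← hn]
    exact Finite.card_subtype_lt (x := x) fun hx => hx (MulAction.mem_orbit_self x)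

/-- For trivial `N` the stable orbits are the fixed points of `θ.range`, so the count is an ordinary
mark. -/
theorem stableCount_bot_eq {Ω : Type*} [Group Ω] (θ : Ω →* G) (X : FinGSet G) :
    (stableCount ⊥ (X.perm θ) : F) = stabSum F
      (Set.indicator {S : Subgroup G | θ.range ≤ S} (fun _ => (1 : F))) (FB.mk F X) := by
  classical
  have := Fintype.ofFinite X.carrier
  rw [stabSum_mk, stableCount, finsum_eq_sum_of_fintype, finsum_eq_sum_of_fintype, Nat.cast_sum]
  refine Finset.sum_congr rfl fun x _ => ?_
  have h : (∀ ω, ∃ n ∈ (⊥ : Subgroup Ω), X.perm θ ω x = X.perm θ n x) ↔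
      MulAction.stabilizer G x ∈ {S : Subgroup G | θ.range ≤ S} := by
    simp only [Subgroup.mem_bot, exists_eq_left, map_one, Equiv.Perm.one_apply,
      Set.mem_ofPred_eq]
    constructor
    · rintro H _ ⟨ω, rfl⟩
      exact H ω
    · intro H ω
      exact H ⟨ω, rfl⟩
  rw [stableWeight, if_congr h rfl rfl, Set.indicator_apply]
  have h1 : Nat.card {n : Ω // n ∈ (⊥ : Subgroup Ω) ∧ X.perm θ n x = x} = 1 := by
    rw [Nat.card_eq_one_iff_unique]
    refine ⟨⟨fun a b => Subtype.ext (a.2.1.trans b.2.1.symm)⟩, ⟨⟨1, Subgroup.one_mem _, ?_⟩⟩⟩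
    rw [map_one, Equiv.Perm.one_apply]
  rw [h1]
  split_ifs <;> simp

/-- Burnside's theorem: an element of the Burnside group all of whose marks vanish is zero. -/
theorem FB.eq_zero_of_marks [Finite G] (a : FB F G)
    (h : ∀ S : Subgroup G, countFun F ⊥ S.subtype a = 0) : a = 0 := by
  classical
  have := Fintype.ofFinite (Subgroup G)
  have h1 : ∀ T : Subgroup G, countFun F ⊥ T.subtype =
      stabSum F (Set.indicator {S : Subgroup G | T ≤ S} (fun _ => (1 : F))) := fun T =>
    FB.hom_ext F fun X => by
      rw [countFun_mk, stableCount_bot_eq, Subgroup.range_subtype]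
  set t : Subgroup G → F := fun S => stabSum F (fun T => if T = S then (1 : F) else 0) a with ht
  have h2 : t = 0 := by
    by_contra hne
    have hfin : (Set.toFinite {S | t S ≠ 0}).toFinset.Nonempty := by
      obtain ⟨S, hS⟩ := Function.ne_iff.1 hne
      exact ⟨S, by simpa using hS⟩
    -- The mark at `S` is the sum of `t` over the overgroups of `S`; at a maximal `S` of the support
    -- it equals `t S`.
    obtain ⟨S, hS⟩ := Finset.exists_maximal hfin
    have hS1 : t S ≠ 0 := by simpa using hS.1
    have h3 := h S
    rw [h1, stabSum_eq, Finset.sum_eq_single S] at h3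
    · simp at h3
      exact hS1 h3
    · intro T _ hT
      by_cases hle : S ≤ T
      · have : t T = 0 := by
          by_contra h0
          exact hT (le_antisymm (hS.2 (by simpa using h0) hle) hle)
        change t T • _ = 0
        rw [this, zero_smul]
      · simp [hle]
    · simp
  have h4 : stabSum F (fun S : Subgroup G => ((Nat.card S : F) * (Nat.card G : F)⁻¹) •
      FB.mk F (FinGSet.coset S)) = LinearMap.id := FB.hom_ext F fun X => by
    rw [stabSum_mk, FB.mk_eq_finsum_coset, LinearMap.id_apply]
  have h5 := LinearMap.congr_fun h4 a
  rw [stabSum_eq] at h5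
  rw [LinearMap.id_apply] at h5
  rw [← h5]
  refine Finset.sum_eq_zero fun S _ => ?_
  change t S • _ = 0
  rw [h2, Pi.zero_apply, zero_smul]

/-- For `S ≤ P × K` take `Ω = S` with `α = β` and `κ` the two projections. The kernels meet
trivially, so the form is the mark at `S`. -/
theorem vanishingSubmodule_self (K : Type u) [Group K] [Finite K] (P : Type u) [Group P]
    [Finite P] : vanishingSubmodule F K P P = ⊥ := by
  rw [eq_bot_iff]
  intro a ha
  refine (Submodule.mem_bot F).2 (FB.eq_zero_of_marks F a fun S => ?_)
  have := mem_vanishingSubmodule.1 ha S inferInstance inferInstance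
    ((MonoidHom.fst P K).comp S.subtype) ((MonoidHom.fst P K).comp S.subtype)
    ((MonoidHom.snd P K).comp S.subtype)
  have hN : ((MonoidHom.fst P K).comp S.subtype).ker ⊓ ((MonoidHom.snd P K).comp S.subtype).ker
      = ⊥ := by
    rw [eq_bot_iff]
    rintro ⟨⟨x, k⟩, hx⟩ ⟨h1, h2⟩
    exact Subtype.ext (Prod.ext h1 h2)
  rw [hN] at this
  exact this

theorem eq_bot_of_generator_mem_vanishing {K : Type u} [Group K] [Finite K] {L : Type u} [Group L]
    [Finite L] (P : Type u) [Group P] [Finite P] (c : FBK F K L)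
    (hc : c ∈ vanishingSubmodule F K P L) : (GreenIdeal.generatedBy c).eval P = ⊥ := by
  rw [eq_bot_iff, ← vanishingSubmodule_self F K P]
  exact iInf₂_le (vanishingIdeal F K P) hc

end Marks

/-! ### The Möbius function of the subgroup lattice. -/

section Moebius

variable {G : Type u} [Group G] [Finite G]

theorem subgroupMu_eq_zero {X Y : Subgroup G} (h : ¬ X ≤ Y) : subgroupMu X Y = 0 := by
  classical
  exact IncidenceAlgebra.apply_eq_zero_of_not_le h _

theorem subgroupMu_self (X : Subgroup G) : subgroupMu X X = 1 := by
  classical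
  let : Fintype (Subgroup G) := Fintype.ofFinite _
  let : LocallyFiniteOrder (Subgroup G) := Fintype.toLocallyFiniteOrder
  exact IncidenceAlgebra.mu_self X

open Classical in
theorem sum_subgroupMu_left [Fintype (Subgroup G)] {X Y : Subgroup G} (h : X ≠ Y) :
    ∑ Z with X ≤ Z, subgroupMu Z Y = 0 := by
  let : LocallyFiniteOrder (Subgroup G) := @Fintype.toLocallyFiniteOrder _ _
    (Fintype.ofFinite _) _ _
  have h1 := IncidenceAlgebra.sum_Icc_mu_left (𝕜 := ℤ) X Y
  rw [if_neg h] at h1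
  rw [← h1]
  symm
  refine Finset.sum_subset (fun Z hZ => by simpa using (Finset.mem_Icc.1 hZ).1) ?_
  intro Z hZ hZ'
  refine IncidenceAlgebra.apply_eq_zero_of_not_le (fun hle => hZ' ?_) _
  exact Finset.mem_Icc.2 ⟨by simpa using hZ, hle⟩

open Classical in
theorem subgroupMu_eq_neg_sum [Fintype (Subgroup G)] {X Y : Subgroup G} (h : X ≠ Y) :
    subgroupMu X Y = -∑ Z with X < Z, subgroupMu Z Y := by
  have h1 := sum_subgroupMu_left h
  have h2 : (Finset.univ.filter fun Z => X ≤ Z) =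
      insert X (Finset.univ.filter fun Z => X < Z) := by
    ext Z
    simp [le_iff_eq_or_lt, eq_comm]
  rw [h2, Finset.sum_insert (by simp)] at h1
  exact eq_neg_of_add_eq_zero_left h1

theorem subgroupMu_coatom {X : Subgroup G} (h : IsCoatom X) : subgroupMu X ⊤ = -1 := by
  classical
  have := Fintype.ofFinite (Subgroup G)
  rw [subgroupMu_eq_neg_sum h.1]
  have : (Finset.univ.filter fun Z => X < Z) = {⊤} := by
    ext Z
    simpa using ⟨fun hZ => h.2 Z hZ, fun hZ => hZ ▸ h.lt_top⟩
  rw [this, Finset.sum_singleton, subgroupMu_self]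

theorem subgroupMu_map {L : Type u} [Group L] [Finite L] {j : L →* G}
    (hj : Function.Injective j) (X Y : Subgroup L) :
    subgroupMu (X.map j) (Y.map j) = subgroupMu X Y := by
  classical
  have := Fintype.ofFinite (Subgroup G)
  have := Fintype.ofFinite (Subgroup L)
  induction X using WellFoundedGT.induction with
  | _ X ih =>
  rcases eq_or_ne X Y with rfl | hXY
  · rw [subgroupMu_self, subgroupMu_self]
  have hne : X.map j ≠ Y.map j := fun h => hXY (Subgroup.map_injective hj h)
  rw [subgroupMu_eq_neg_sum hne, subgroupMu_eq_neg_sum hXY]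
  congr 1
  have h1 : ∑ Z with X < Z, subgroupMu Z Y =
      ∑ Z with X < Z, subgroupMu (Z.map j) (Y.map j) :=
    Finset.sum_congr rfl fun Z hZ => (ih Z (by simpa using hZ)).symm
  rw [h1, ← Finset.sum_image (f := fun Z => subgroupMu Z (Y.map j))
    (g := fun Z : Subgroup L => Z.map j) ((Subgroup.map_injective hj).injOn)]
  symm
  refine Finset.sum_subset ?_ ?_
  · intro Z hZ
    obtain ⟨T, hT, rfl⟩ := Finset.mem_image.1 hZ
    have hT : X < T := by simpa using hT
    exact Finset.mem_filter.2
      ⟨Finset.mem_univ _, (Subgroup.map_lt_map_iff_of_injective hj).2 hT⟩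
  · intro Z hZ hZ'
    refine subgroupMu_eq_zero fun hle => hZ' (Finset.mem_image.2 ⟨Z.comap j, ?_, ?_⟩)
    · have hlt : X.map j < Z := by simpa using hZ
      have hZj : (Z.comap j).map j = Z :=
        Subgroup.map_comap_eq_self (hle.trans (Subgroup.map_le_range j Y))
      rw [← hZj] at hlt
      simpa using (Subgroup.map_lt_map_iff_of_injective hj).1 hlt
    · exact Subgroup.map_comap_eq_self (hle.trans (Subgroup.map_le_range j Y))

/-- A form of Weisner's theorem. -/
theorem sum_subgroupMu_mul_eq_zero [Fintype (Subgroup G)] {R : Type*} [CommRing R]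
    {D : Subgroup G} (hD : D ≠ ⊤)
    (h : Subgroup G → R) (hh : ∀ X, h X = h (X ⊓ D)) :
    ∑ X, (subgroupMu X ⊤ : R) * h X = 0 := by
  classical
  -- Descending induction on `U`: the sum over all `X ≥ U` vanishes, and splitting it by the value
  -- of `X ⊓ D` leaves only the part with value `U`.
  have key : ∀ U : Subgroup G, ∑ X with X ⊓ D = U, subgroupMu X ⊤ = 0 := by
    intro U
    induction U using WellFoundedGT.induction with
    | _ U ih =>
    by_cases hU : U ≤ D
    · have hU' : U ≠ ⊤ := fun h => hD (top_le_iff.1 (h ▸ hU))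
      have h1 := sum_subgroupMu_left hU'
      rw [← Finset.sum_fiberwise_of_maps_to (t := Finset.univ.filter fun V => U ≤ V)
        (g := fun X => X ⊓ D)] at h1
      · rw [Finset.sum_eq_single U] at h1
        · rw [← h1]
          refine Finset.sum_congr ?_ fun _ _ => rfl
          ext X
          simp only [Finset.mem_filter, Finset.mem_univ, true_and]
          exact ⟨fun hX => ⟨hX ▸ inf_le_left, hX⟩, fun hX => hX.2⟩
        · intro V hV hne
          have hV : U ≤ V := by simpa using hV
          rw [← ih V (lt_of_le_of_ne hV hne.symm)]
          refine Finset.sum_congr ?_ fun _ _ => rfl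
          ext X
          simp only [Finset.mem_filter, Finset.mem_univ, true_and]
          exact ⟨fun hX => hX.2, fun hX => ⟨hV.trans (hX ▸ inf_le_left), hX⟩⟩
        · simp
      · intro X hX
        simpa using ⟨by simpa using hX, hU⟩
    · refine Finset.sum_eq_zero fun X hX => (hU ?_).elim
      have : X ⊓ D = U := by simpa using hX
      exact this ▸ inf_le_right
  rw [← Finset.sum_fiberwise_of_maps_to (t := Finset.univ) (g := fun X => X ⊓ D)
    fun _ _ => Finset.mem_univ _]
  refine Finset.sum_eq_zero fun U _ => ?_
  have : ∑ X with X ⊓ D = U, (subgroupMu X ⊤ : R) * h X =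
      ∑ X with X ⊓ D = U, (subgroupMu X ⊤ : R) * h U := by
    refine Finset.sum_congr rfl fun X hX => ?_
    rw [hh X, show X ⊓ D = U by simpa using hX]
  rw [this, ← Finset.sum_mul, ← Int.cast_sum, key, Int.cast_zero, zero_mul]

end Moebius

/-! ### Stable orbits on coset spaces and the idempotents. -/

section CosetCount

variable {Ω : Type*} [Group Ω] {G : Type u} [Group G]

open Classical in
/-- The weight of the base point of the coset space of `X`, in terms of elements. -/
noncomputable def cosetWeight (N : Subgroup Ω) (θ : Ω →* G) (X : Subgroup G) : ℕ :=
  if ∀ ω, ∃ n ∈ N, θ (n⁻¹ * ω) ∈ X then Nat.card {n : Ω // n ∈ N ∧ θ n ∈ X} else 0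

/-- The weight of the coset `gX` is the base-point weight for `gXg⁻¹`; summing over elements instead
of cosets counts each coset `|X|` times. -/
theorem card_mul_stableCount_coset [Fintype G] (N : Subgroup Ω) (θ : Ω →* G) (X : Subgroup G) :
    Nat.card X * stableCount N ((FinGSet.coset X).perm θ) =
      ∑ g : G, cosetWeight N θ (X.map (MulAut.conj g).toMonoidHom) := by
  classical
  have := Fintype.ofFinite (FinGSet.coset X).carrier
  have h1 : ∀ g : G, cosetWeight N θ (X.map (MulAut.conj g).toMonoidHom) =
      stableWeight N ((FinGSet.coset X).perm θ) ((g : G ⧸ X) : (FinGSet.coset X).carrier) := by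
    intro g
    have hmem : ∀ x : G, x ∈ X.map (MulAut.conj g).toMonoidHom ↔ g⁻¹ * x * g ∈ X := by
      intro x
      rw [Subgroup.mem_map_equiv]
      simp [MulAut.conj_symm_apply]
    have hact : ∀ a b : Ω, (FinGSet.coset X).perm θ a (g : G ⧸ X) =
        (FinGSet.coset X).perm θ b (g : G ⧸ X) ↔
          θ (b⁻¹ * a) ∈ X.map (MulAut.conj g).toMonoidHom := by
      intro a b
      change ((θ a * g : G) : G ⧸ X) = ((θ b * g : G) : G ⧸ X) ↔ _
      rw [eq_comm, QuotientGroup.eq, hmem]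
      simp [mul_assoc]
    have hfix : ∀ a : Ω, (FinGSet.coset X).perm θ a (g : G ⧸ X) = (g : G ⧸ X) ↔
          θ a ∈ X.map (MulAut.conj g).toMonoidHom := by
      intro a
      have := hact a 1
      rw [map_one, inv_one, one_mul] at this
      exact this
    unfold cosetWeight stableWeight
    refine if_congr ?_ ?_ rfl
    · exact forall_congr' fun ω => exists_congr fun n => and_congr_right fun _ => (hact ω n).symm
    · exact Nat.card_congr (Equiv.subtypeEquivRight fun n =>
        and_congr_right fun _ => (hfix n).symm)
  simp only [h1]
  rw [stableCount, finsum_eq_sum_of_fintype, Finset.mul_sum,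
    ← Finset.sum_fiberwise_of_maps_to (t := Finset.univ)
      (g := fun g : G => (show (FinGSet.coset X).carrier from (g : G ⧸ X)))
      fun _ _ => Finset.mem_univ _]
  refine Finset.sum_congr rfl fun c _ => ?_
  rw [Finset.sum_eq_card_nsmul (b := stableWeight N ((FinGSet.coset X).perm θ) c) fun g hg =>
    congrArg _ (Finset.mem_filter.1 hg).2, smul_eq_mul]
  congr 1
  have h3 : ∀ c : G ⧸ X, Nat.card {g : G // (g : G ⧸ X) = c} = Nat.card X := fun c =>
    (QuotientGroup.card_preimage_mk X {c}).trans (by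
      rw [Nat.card_coe_set_eq, Set.ncard_singleton, mul_one])
  rw [← h3 c, ← Fintype.card_subtype, ← Nat.card_eq_fintype_card]
  rfl

variable {L : Type u} [Group L]

theorem normal_comap_map (N : Subgroup Ω) [N.Normal] (θ : Ω →* G) {i : L →* G}
    (hr : i.range ≤ θ.range) : ((N.map θ).comap i).Normal := by
  refine ⟨?_⟩
  rintro m ⟨n, hn, hnm⟩ l
  obtain ⟨ω, hω⟩ := hr ⟨l, rfl⟩
  exact ⟨ω * n * ω⁻¹, ‹N.Normal›.conj_mem n hn ω, by simp [hω, hnm]⟩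

theorem card_inf_mul_relIndex (A B : Subgroup L) :
    Nat.card (A ⊓ B : Subgroup L) * A.relIndex B = Nat.card B := by
  rw [Subgroup.relIndex, ← Subgroup.card_mul_index (A.subgroupOf B)]
  congr 1
  rw [← Subgroup.inf_subgroupOf_right]
  exact (Nat.card_congr (Subgroup.subgroupOfEquivOfLe inf_le_right).toEquiv).symm

/-- Let `A` be the part of `N` that `θ` sends into `i.range`. Its map `π` to `L` has image `M`, so
the preimage of `X` has index `|M : X ∩ M|` in `A`. Since `XM = L`, this index is `|L : X|`. -/
theorem card_fiber_mul_card [Finite Ω] (N : Subgroup Ω) [N.Normal] (θ : Ω →* G) {i : L →* G}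
    (hi : Function.Injective i) (hr : i.range ≤ θ.range) (X : Subgroup L)
    (hX : X ⊔ (N.map θ).comap i = ⊤) :
    Nat.card {n : Ω // n ∈ N ∧ θ n ∈ X.map i} * Nat.card L =
      Nat.card X * Nat.card {n : Ω // n ∈ N ∧ θ n ∈ i.range} := by
  set M : Subgroup L := (N.map θ).comap i with hM
  have hMn : M.Normal := normal_comap_map N θ hr
  let A : Subgroup Ω := N ⊓ i.range.comap θ
  let π : A →* L := (MonoidHom.ofInjective hi).symm.toMonoidHom.comp
    ((θ.comp A.subtype).codRestrict i.range fun a => a.2.2)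
  have hπ : ∀ a : A, i (π a) = θ a := fun a =>
    congrArg Subtype.val ((MonoidHom.ofInjective hi).apply_symm_apply _)
  have hrange : π.range = M := by
    ext l
    constructor
    · rintro ⟨a, rfl⟩
      exact ⟨a, a.2.1, (hπ a).symm⟩
    · rintro ⟨n, hn, hnl⟩
      exact ⟨⟨n, hn, l, hnl.symm⟩, hi ((hπ _).trans hnl)⟩
  have h1 : Nat.card {n : Ω // n ∈ N ∧ θ n ∈ X.map i} = Nat.card (X.comap π) := by
    refine Nat.card_congr ⟨fun n => ⟨⟨n.1, n.2.1, ?_⟩, ?_⟩, fun a => ⟨a.1, a.1.2.1, ?_⟩, ?_, ?_⟩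
    · obtain ⟨x, -, hx⟩ := n.2.2
      exact ⟨x, hx⟩
    · obtain ⟨x, hx, hxn⟩ := n.2.2
      have : π ⟨n.1, n.2.1, ⟨x, hxn⟩⟩ = x := hi ((hπ _).trans hxn.symm)
      rw [Subgroup.mem_comap, this]
      exact hx
    · exact ⟨π a.1, a.2, hπ _⟩
    · intro n; rfl
    · intro n; rfl
  have h2 : Nat.card {n : Ω // n ∈ N ∧ θ n ∈ i.range} = Nat.card A := rfl
  have h3 := Subgroup.card_mul_index (X.comap π)
  rw [Subgroup.index_comap, hrange] at h3
  have h4 := card_inf_mul_relIndex X M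
  have h5 := card_inf_mul_relIndex M X
  rw [← Subgroup.relIndex_sup_right, hX, Subgroup.relIndex_top_right, inf_comm] at h5
  have h6 := Subgroup.card_mul_index M
  rw [h1, h2, ← h6, ← h5, ← h4, ← h3]
  ring

variable (F : Type w) [Field F] [CharZero F] [Finite L]

open scoped Pointwise in
theorem mCoeff_eq_zero_iff [Fintype (Subgroup L)] [DecidableEq (Subgroup L)]
    (M : Subgroup L) [M.Normal] :
    mCoeff M = 0 ↔ ∑ X : Subgroup L with X ⊔ M = ⊤, (Nat.card X : ℤ) * subgroupMu X ⊤ = 0 := by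
  have hset : (Set.toFinite {X : Subgroup L | (X : Set L) * (M : Set L) = Set.univ}).toFinset =
      Finset.univ.filter fun X => X ⊔ M = ⊤ := by
    ext X
    rw [Set.Finite.mem_toFinset, Finset.mem_filter, ← Subgroup.coe_eq_univ, Subgroup.mul_normal]
    simp
  rw [mCoeff, hset, mul_eq_zero,
    or_iff_right (inv_ne_zero (Nat.cast_ne_zero.2 Nat.card_pos.ne'))]
  exact_mod_cast Iff.rfl

/-- If `i.range` is not inside `θ.range`, the sum dies by Weisner's theorem. Otherwise the weight of
`X` is either always zero, or a constant times `|X|` when `XM = L` and zero when not; the sum is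
then a multiple of `m_{L,M}`. -/
theorem sum_mu_mul_cosetWeight [Fintype (Subgroup L)] [Finite Ω] (N : Subgroup Ω) [N.Normal]
    (θ : Ω →* G) {i : L →* G} (hi : Function.Injective i)
    (h : i.range ≤ θ.range → mCoeff ((N.map θ).comap i) = 0) :
    ∑ X : Subgroup L, (subgroupMu X ⊤ : F) * (cosetWeight N θ (X.map i) : F) = 0 := by
  classical
  by_cases hr : i.range ≤ θ.range
  swap
  -- The weight tests membership only for elements of `θ.range`, hence depends only on the
  -- intersection of `X` with this proper subgroup.
  · refine sum_subgroupMu_mul_eq_zero (D := θ.range.comap i) ?_ _ fun X => ?_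
    · intro hD
      refine hr ?_
      rintro _ ⟨l, rfl⟩
      exact Subgroup.mem_comap.1 (hD ▸ Subgroup.mem_top l)
    · have hmem : ∀ ω, θ ω ∈ X.map i ↔ θ ω ∈ (X ⊓ θ.range.comap i).map i := by
        intro ω
        constructor
        · rintro ⟨x, hx, hxω⟩
          exact ⟨x, ⟨hx, ω, hxω.symm⟩, hxω⟩
        · rintro ⟨x, hx, hxω⟩
          exact ⟨x, hx.1, hxω⟩
      simp only [cosetWeight, hmem]
  set M : Subgroup L := (N.map θ).comap i with hM
  have hMn : M.Normal := normal_comap_map N θ hr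
  by_cases hc : ∀ ω, ∃ n ∈ N, θ (n⁻¹ * ω) ∈ i.range
  swap
  · refine Finset.sum_eq_zero fun X _ => ?_
    rw [cosetWeight, if_neg, Nat.cast_zero, mul_zero]
    intro H
    refine hc fun ω => ?_
    obtain ⟨n, hn, x, -, hx⟩ := H ω
    exact ⟨n, hn, x, hx⟩
  set a : ℕ := Nat.card {n : Ω // n ∈ N ∧ θ n ∈ i.range}
  have hL : (Nat.card L : F) ≠ 0 := Nat.cast_ne_zero.2 Nat.card_pos.ne'
  have hiff : ∀ X : Subgroup L, (∀ ω, ∃ n ∈ N, θ (n⁻¹ * ω) ∈ X.map i) ↔ X ⊔ M = ⊤ := by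
    intro X
    rw [sup_comm]
    constructor
    · intro H
      rw [eq_top_iff]
      intro l _
      obtain ⟨ω, hω⟩ := hr ⟨l, rfl⟩
      obtain ⟨n, hn, x, hx, hxn⟩ := H ω
      rw [map_mul, hω, map_inv] at hxn
      have hlx : l * x⁻¹ ∈ M := ⟨n, hn, by rw [map_mul, map_inv, hxn]; simp⟩
      simpa using Subgroup.mul_mem_sup hlx hx
    · intro H ω
      obtain ⟨n, hn, l, hl⟩ := hc ω
      have hl' : l ∈ ((M ⊔ X : Subgroup L) : Set L) := H ▸ Subgroup.mem_top l
      rw [Subgroup.normal_mul] at hl'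
      obtain ⟨m, ⟨n', hn', hm⟩, x, hx, rfl⟩ := Set.mem_mul.1 hl'
      refine ⟨n * n', N.mul_mem hn hn', x, hx, ?_⟩
      rw [mul_inv_rev, mul_assoc, map_mul, ← hl, map_mul, map_inv, hm]
      simp
  have hterm : ∀ X : Subgroup L, (cosetWeight N θ (X.map i) : F) =
      if X ⊔ M = ⊤ then (Nat.card X : F) * ((a : F) * (Nat.card L : F)⁻¹) else 0 := by
    intro X
    rw [cosetWeight, if_congr (hiff X) rfl rfl]
    split_ifs with hX
    · have := congrArg (Nat.cast : ℕ → F) (card_fiber_mul_card N θ hi hr X hX)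
      rw [Nat.cast_mul, Nat.cast_mul] at this
      rw [← mul_assoc, ← this, mul_inv_cancel_right₀ hL]
    · simp
  have hm := congrArg (Int.cast : ℤ → F) ((mCoeff_eq_zero_iff M).1 (h hr))
  rw [Int.cast_sum, Int.cast_zero] at hm
  rw [Finset.sum_congr rfl fun X _ => congrArg _ (hterm X)]
  simp only [mul_ite, mul_zero]
  rw [← Finset.sum_filter, ← zero_mul ((a : F) * (Nat.card L : F)⁻¹), ← hm, Finset.sum_mul]
  refine Finset.sum_congr rfl fun X _ => ?_
  push_cast
  ring

/-- The vanishing criterion for the forms `countFun` on a Gluck--Yoshida idempotent. -/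
theorem countFun_idem_eq_zero [Finite Ω] [Finite G] (N : Subgroup Ω) [N.Normal]
    (θ : Ω →* G) {j : L →* G} (hj : Function.Injective j)
    (h : ∀ g : G, ((MulAut.conj g).toMonoidHom.comp j).range ≤ θ.range →
      mCoeff ((N.map θ).comap ((MulAut.conj g).toMonoidHom.comp j)) = 0) :
    countFun F N θ (idem F j.range) = 0 := by
  classical
  have := Fintype.ofFinite G
  have := Fintype.ofFinite (Subgroup L)
  have hset : (Set.toFinite {X : Subgroup G | X ≤ j.range}).toFinset =
      Finset.univ.image fun X : Subgroup L => X.map j := by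
    ext X
    rw [Set.Finite.mem_toFinset, Finset.mem_image]
    constructor
    · intro hX
      exact ⟨X.comap j, Finset.mem_univ _, Subgroup.map_comap_eq_self hX⟩
    · rintro ⟨X, -, rfl⟩
      exact Subgroup.map_le_range j X
  rw [idem, map_smul, hset, Finset.sum_image ((Subgroup.map_injective hj).injOn), map_sum]
  -- The coefficient `|X|` in the Gluck–Yoshida formula is exactly what turns the sum over cosets
  -- into one over elements `g`. The sums can then be exchanged, and each `g` treated separately
  -- through the conjugated embedding.
  have hterm : ∀ X : Subgroup L, countFun F N θ
      (((Nat.card (X.map j) : F) * (subgroupMu (X.map j) j.range : F)) •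
        FB.mk F (FinGSet.coset (X.map j))) =
      ∑ g : G, (subgroupMu X ⊤ : F) *
        (cosetWeight N θ (X.map ((MulAut.conj g).toMonoidHom.comp j)) : F) := by
    intro X
    rw [map_smul, countFun_mk, smul_eq_mul, ← Finset.mul_sum, MonoidHom.range_eq_map,
      subgroupMu_map hj, mul_comm (Nat.card _ : F), mul_assoc, ← Nat.cast_mul,
      card_mul_stableCount_coset, Nat.cast_sum]
    simp only [Subgroup.map_map]
  rw [Finset.sum_congr rfl fun X _ => hterm X, Finset.sum_comm, Finset.sum_eq_zero, smul_zero]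
  intro g _
  exact sum_mu_mul_cosetWeight F N θ ((MulAut.conj g).injective.comp hj) (h g)

end CosetCount

/-! ### Persistence forces `Ker φ ∩ O^p(L) = 1`. -/

section Persistence

/-- It suffices to lift an `x` of order prime to `p`. A suitable `p^k`-th power of any lift dies in
`P`, and a further power restores `x`, because `p^k` is invertible modulo the order of `x`. -/
theorem exists_lift_of_mem_pResidual {p : ℕ} {L : Type u} [Group L] {Ω : Type u} [Group Ω] [Finite Ω] {P : Type u} [Group P]
    (hP : IsPGroup p P) {G : Type u} [Group G] (α : Ω →* P) (θ : Ω →* G) (i : L →* G)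
    (hr : i.range ≤ θ.range) {s : L} (hs : s ∈ pResidual p L) :
    ∃ ω, θ ω = i s ∧ α ω = 1 := by
  suffices h : pResidual p L ≤ (α.ker.map θ).comap i by
    obtain ⟨ω, h1, h2⟩ := h hs
    exact ⟨ω, h2, h1⟩
  refine (Subgroup.closure_le _).2 fun x hx => ?_
  obtain ⟨ω, hω⟩ := hr ⟨x, rfl⟩
  obtain ⟨k, hk⟩ := hP (α ω)
  have hcop : (orderOf x).Coprime (p ^ k) := Nat.Coprime.pow_right k hx
  obtain ⟨m, hm⟩ := exists_pow_eq_self_of_coprime hcop.symm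
  refine ⟨(ω ^ p ^ k) ^ m, ?_, ?_⟩
  · rw [SetLike.mem_coe, MonoidHom.mem_ker, map_pow, map_pow, hk, one_pow]
  · rw [map_pow, map_pow, hω, ← map_pow, ← map_pow, hm]

theorem ker_inf_pResidual_eq_bot (F : Type w) [Field F] [CharZero F] {p : ℕ}
    {K : Type u} [Group K] [Finite K] {L : Type u} [Group L] [Finite L] {φ : L →* K} (hB : IsBGroup φ) (hp : IsPersistent F p φ) :
    φ.ker ⊓ pResidual p L = ⊥ := by
  by_contra hne
  obtain ⟨P, _, _, hP, hPne⟩ := hp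
  refine hPne (eq_bot_of_generator_mem_vanishing F P _ (mem_vanishingSubmodule.2 ?_))
  intro Ω _ _ α β κ
  set j : L →* L × K := (MonoidHom.id L).prod φ with hj
  have hgraph : φ.graph = j.range := by
    ext ⟨l, k⟩
    simp [hj, MonoidHom.mem_graph, MonoidHom.mem_range, eq_comm]
  rw [hgraph]
  refine countFun_idem_eq_zero F _ _ (fun a b hab => congrArg Prod.fst hab) fun g hr => ?_
  set i := (MulAut.conj g).toMonoidHom.comp j with hi
  have hi2 : ∀ l, (i l).2 = g.2 * φ l * g.2⁻¹ := fun l => rfl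
  set N := α.ker ⊓ κ.ker
  -- The preimage of the image of `N` lies in `Ker φ` by comparing `K`-coordinates, and it contains
  -- `Ker φ ∩ O^p(L)` by lifting, so it is trivial only if that intersection is.
  refine hB _ (normal_comap_map N _ hr) ?_ fun hbot => hne ?_
  · rintro l ⟨n, hn, hnl⟩
    have h1 : κ n = g.2 * φ l * g.2⁻¹ := (congrArg Prod.snd hnl).trans (hi2 l)
    rw [show κ n = 1 from hn.2] at h1
    rw [MonoidHom.mem_ker]
    simpa using h1.symm
  · rw [eq_bot_iff]
    rintro s ⟨hs1, hs2⟩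
    obtain ⟨ω, h1, h2⟩ := exists_lift_of_mem_pResidual hP α (β.prod κ) i hr hs2
    have h3 : κ ω = 1 := by
      have : κ ω = (i s).2 := congrArg Prod.snd h1
      rw [this, hi2, show φ s = 1 from hs1]
      simp
    rw [← hbot]
    exact ⟨ω, ⟨h2, h3⟩, h1⟩

end Persistence

/-! ### Homomorphisms to `C_p` and the quotient by `O^p`. -/

section PQuotient

variable {p : ℕ} [hp : Fact p.Prime]

theorem card_cyc {p : ℕ} : Nat.card (Cyc p) = p :=
  (Nat.card_congr Multiplicative.toAdd).trans (Nat.card_zmod p)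

instance : Finite (Cyc p) := Nat.finite_of_card_ne_zero (by rw [card_cyc]; exact hp.out.ne_zero)

theorem exists_ker_eq_of_isCoatom {Q : Type*} [Group Q] [Finite Q] (hQ : IsPGroup p Q)
    {M : Subgroup Q} (hM : IsCoatom M) : ∃ f : Q →* Cyc p, f.ker = M := by
  have := hQ.isNilpotent
  have hMn : M.Normal :=
    Subgroup.NormalizerCondition.normal_of_coatom M Group.normalizerCondition_of_isNilpotent hM
  have hnt : Nontrivial (Q ⧸ M) := QuotientGroup.nontrivial_iff.2 hM.1
  have hs : IsSimpleGroup (Q ⧸ M) := by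
    refine ⟨fun H _ => ?_⟩
    have hle : M ≤ H.comap (QuotientGroup.mk' M) := fun x hx => by
      rw [Subgroup.mem_comap, QuotientGroup.mk'_apply, (QuotientGroup.eq_one_iff x).2 hx]
      exact H.one_mem
    have hmap := Subgroup.map_comap_eq_self_of_surjective (QuotientGroup.mk'_surjective M) H
    rcases hM.le_iff.1 hle with h | h
    · right
      rw [← hmap, h, Subgroup.map_top_of_surjective _ (QuotientGroup.mk'_surjective M)]
    · left
      rw [← hmap, h, QuotientGroup.map_mk'_self]
  have hprime : (Nat.card (Q ⧸ M)).Prime := IsSimpleGroup.prime_card (α := Q ⧸ M)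
  obtain ⟨n, hn⟩ := IsPGroup.iff_card.1 (hQ.to_quotient M)
  have hcard : Nat.card (Q ⧸ M) = p := by
    rw [hn] at hprime ⊢
    rw [Nat.Prime.eq_one_of_pow hprime, pow_one]
  let e : Q ⧸ M ≃* Cyc p := mulEquivOfPrimeCardEq hcard card_cyc
  refine ⟨(e : Q ⧸ M →* Cyc p).comp (QuotientGroup.mk' M), ?_⟩
  rw [MonoidHom.ker_mulEquiv_comp, QuotientGroup.ker_mk']

theorem subsingleton_of_forall_hom_eq_one {Q : Type*} [Group Q] [Finite Q] (hQ : IsPGroup p Q)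
    (h : ∀ f : Q →* Cyc p, f = 1) : Subsingleton Q := by
  rcases eq_top_or_exists_le_coatom (⊥ : Subgroup Q) with hbt | ⟨M, hM, -⟩
  · exact Subgroup.subsingleton_iff.1 (subsingleton_of_bot_eq_top hbt)
  · obtain ⟨f, rfl⟩ := exists_ker_eq_of_isCoatom hQ hM
    exact (hM.1 (by rw [h f, MonoidHom.ker_one])).elim

/-- Maximal subgroups are kernels of non-trivial maps to `C_p`. If these maps, with the trivial one,
form a group of order `p`, any two are powers of each other, so there is one maximal subgroup and
any element outside it generates. -/
theorem isCyclic_of_card_hom {Q : Type*} [Group Q] [Finite Q] (hQ : IsPGroup p Q)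
    (h : Nat.card (Q →* Cyc p) = p) : IsCyclic Q := by
  by_contra hc
  have hmax : ∀ x : Q, ∃ M, IsCoatom M ∧ Subgroup.zpowers x ≤ M := fun x =>
    (eq_top_or_exists_le_coatom (Subgroup.zpowers x)).resolve_left fun ht =>
      hc (isCyclic_iff_exists_zpowers_eq_top.2 ⟨x, ht⟩)
  obtain ⟨M, hM, -⟩ := hmax 1
  obtain ⟨x, -, hx⟩ := SetLike.exists_of_lt hM.lt_top
  obtain ⟨M', hM', hxM'⟩ := hmax x
  obtain ⟨f, rfl⟩ := exists_ker_eq_of_isCoatom hQ hM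
  obtain ⟨f', rfl⟩ := exists_ker_eq_of_isCoatom hQ hM'
  have hf : f ≠ 1 := fun h1 => hM.1 (by rw [h1, MonoidHom.ker_one])
  obtain ⟨k, rfl⟩ := Subgroup.mem_zpowers_iff.1 (mem_zpowers_of_prime_card h hf (g' := f'))
  have hle : f.ker ≤ (f ^ k).ker := fun y hy => by
    rw [MonoidHom.mem_ker] at hy ⊢
    rw [MonoidHom.zpow_apply, hy, one_zpow]
  have heq := (hM.le_iff.1 hle).resolve_left hM'.1
  exact hx (heq ▸ hxM' (Subgroup.mem_zpowers x))

theorem exists_pow_mem_pResidual {L : Type u} [Group L] [Finite L] (x : L) :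
    ∃ k, x ^ p ^ k ∈ pResidual p L := by
  obtain ⟨k, m, hm, hx⟩ := Nat.exists_eq_pow_mul_and_not_dvd
    (orderOf_pos x).ne' p hp.out.ne_one
  refine ⟨k, Subgroup.subset_closure ?_⟩
  have : orderOf (x ^ p ^ k) = m := by
    rw [orderOf_pow, hx, Nat.gcd_eq_right (dvd_mul_right _ _),
      Nat.mul_div_cancel_left _ (pow_pos hp.out.pos k)]
  change (orderOf (x ^ p ^ k)).Coprime p
  rw [this]
  exact ((Nat.Prime.coprime_iff_not_dvd hp.out).2 hm).symm

theorem isPGroup_pQuot {L : Type u} [Group L] [Finite L] : IsPGroup p (pQuot p L) := by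
  rw [isPGroup_iff_pow_pow_eq_one]
  rintro ⟨x⟩
  obtain ⟨k, hk⟩ := exists_pow_mem_pResidual (p := p) x
  exact ⟨k, (QuotientGroup.eq_one_iff _).2 hk⟩

theorem pow_cyc_eq_one (x : Cyc p) : x ^ p = 1 := by
  have h : x ^ Nat.card (Cyc p) = 1 := pow_card_eq_one'
  rwa [card_cyc] at h

theorem hom_pQuot_bijective (L : Type u) [Group L] : Function.Bijective
    (fun f : pQuot p L →* Cyc p => f.comp (QuotientGroup.mk' (pResidual p L))) := by
  constructor
  · intro f g h
    exact (MonoidHom.cancel_right (QuotientGroup.mk'_surjective _)).1 h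
  · intro f
    have h : pResidual p L ≤ f.ker := by
      refine (Subgroup.closure_le _).2 fun x hx => ?_
      have h1 : orderOf (f x) ∣ orderOf x := orderOf_map_dvd f x
      have h2 : orderOf (f x) ∣ p := orderOf_dvd_of_pow_eq_one (pow_cyc_eq_one _)
      have h3 : orderOf (f x) ∣ 1 := hx ▸ Nat.dvd_gcd h1 h2
      exact orderOf_eq_one_iff.1 (Nat.dvd_one.1 h3)
    exact ⟨QuotientGroup.lift _ f h, MonoidHom.ext fun x => rfl⟩

theorem subsingleton_pQuot {L : Type u} [Group L] [Finite L] (h : ∀ f : L →* Cyc p, f = 1) :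
    Subsingleton (pQuot p L) :=
  subsingleton_of_forall_hom_eq_one isPGroup_pQuot fun _ =>
    (hom_pQuot_bijective L).1 ((h _).trans (h _).symm)

theorem isCyclic_pQuot {L : Type u} [Group L] [Finite L] (h : Nat.card (L →* Cyc p) = p) :
    IsCyclic (pQuot p L) ∧ Nontrivial (pQuot p L) := by
  have hcard : Nat.card (pQuot p L →* Cyc p) = p :=
    (Nat.card_congr (Equiv.ofBijective _ (hom_pQuot_bijective L))).trans h
  refine ⟨isCyclic_of_card_hom isPGroup_pQuot hcard, ?_⟩
  by_contra hn
  have := not_nontrivial_iff_subsingleton.1 hn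
  have hs : Subsingleton (pQuot p L →* Cyc p) :=
    ⟨fun f g => MonoidHom.ext fun x => by rw [Subsingleton.elim x 1, map_one, map_one]⟩
  rw [Nat.card_unique] at hcard
  exact hp.out.ne_one hcard.symm

end PQuotient

/-! ### Central subgroups of order `p` and their complements. -/

section Central

variable {p : ℕ} [hp : Fact p.Prime] {L : Type u} [Group L]

theorem normal_of_le_center {N : Subgroup L} (hN : N ≤ Subgroup.center L) : N.Normal :=
  ⟨fun n hn g => by rwa [Subgroup.mem_center_iff.1 (hN hn) g, mul_inv_cancel_right]⟩

/-- Some `p`-power of each element lies in `O^p(L)`, so `A` is a `p`-group. Being disjoint normal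
subgroups, `A` and `O^p(L)` commute, so the `p`-group `L / O^p(L)` acts on `A` and fixes a
non-trivial element. -/
theorem exists_central_card_eq [Finite L] {A : Subgroup L} [A.Normal] (hA : A ≠ ⊥)
    (h : A ⊓ pResidual p L = ⊥) :
    ∃ N ≤ A, N ≤ Subgroup.center L ∧ Nat.card N = p := by
  have hcomm : pResidual p L ≤ (MulAut.conjNormal (H := A)).ker := by
    intro x hx
    refine MulEquiv.ext fun a => Subtype.ext ?_
    have := Subgroup.commute_of_normal_of_disjoint A (pResidual p L) inferInstance inferInstance
      (disjoint_iff.2 h) a x a.2 hx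
    rw [MulAut.conjNormal_apply, ← this.eq]
    simp
  have hpA : IsPGroup p A := by
    rw [isPGroup_iff_pow_pow_eq_one]
    intro a
    obtain ⟨k, hk⟩ := exists_pow_mem_pResidual (p := p) (a : L)
    refine ⟨k, Subtype.ext ?_⟩
    have : (a : L) ^ p ^ k ∈ A ⊓ pResidual p L := ⟨A.pow_mem a.2 _, hk⟩
    rw [h] at this
    exact this
  let c : pQuot p L →* MulAut A := QuotientGroup.lift _ MulAut.conjNormal hcomm
  let := MulAction.compHom A c
  have hnt : Nontrivial A := (Subgroup.nontrivial_iff_ne_bot A).2 hA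
  obtain ⟨n, hn0, hn⟩ := hpA.nontrivial_iff_card.1 hnt
  obtain ⟨b, hb, hb1⟩ := (isPGroup_pQuot (p := p) (L := L)).exists_fixed_point_of_prime_dvd_card_of_fixed_point
    A (hn ▸ dvd_pow_self p hn0.ne') (a := 1) (fun g => map_one (c g))
  have hbc : (b : L) ∈ Subgroup.center L := by
    rw [Subgroup.mem_center_iff]
    intro g
    have h1 : MulAut.conjNormal g b = b := hb (QuotientGroup.mk g)
    have h2 := congrArg Subtype.val h1
    rw [MulAut.conjNormal_apply] at h2
    exact mul_inv_eq_iff_eq_mul.1 h2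
  have hd : p ∣ orderOf (b : L) := by
    rw [Subgroup.orderOf_coe]
    exact hpA.dvd_orderOf hb1.symm
  refine ⟨Subgroup.zpowers ((b : L) ^ (orderOf (b : L) / p)), ?_, ?_, ?_⟩
  · rw [Subgroup.zpowers_le]
    exact A.pow_mem b.2 _
  · rw [Subgroup.zpowers_le]
    exact Subgroup.pow_mem _ hbc _
  · rw [Nat.card_zpowers, orderOf_pow_orderOf_div (orderOf_pos _).ne' hd]

variable (p) in
/-- The homomorphisms to the cyclic group of order `p` that are trivial on `N`. -/
def homAnnihilator (N : Subgroup L) : Subgroup (L →* Cyc p) where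
  carrier := {f | ∀ n ∈ N, f n = 1}
  one_mem' := fun _ _ => rfl
  mul_mem' := fun {_ _} hf hg n hn => by rw [MonoidHom.mul_apply, hf n hn, hg n hn, one_mul]
  inv_mem' := fun {_} hf n hn => by rw [MonoidHom.inv_apply, hf n hn, inv_one]

theorem exists_mul_zpow_mem_homAnnihilator {N : Subgroup L} (hc : Nat.card N = p)
    {f₀ : L →* Cyc p} {n₀ : L} (hn₀ : n₀ ∈ N) (hf₀ : f₀ n₀ ≠ 1) (f : L →* Cyc p) :
    ∃ k : ℤ, f * f₀ ^ k ∈ homAnnihilator p N := by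
  obtain ⟨k, hk⟩ := Subgroup.mem_zpowers_iff.1
    (mem_zpowers_of_prime_card card_cyc hf₀ (g' := (f n₀)⁻¹))
  refine ⟨k, fun n hn => ?_⟩
  have hne : (⟨n₀, hn₀⟩ : N) ≠ 1 := fun h => hf₀ (by
    rw [show n₀ = 1 from congrArg Subtype.val h, map_one])
  obtain ⟨m, hm⟩ := Subgroup.mem_zpowers_iff.1
    (mem_zpowers_of_prime_card hc hne (g' := (⟨n, hn⟩ : N)))
  have hm : n₀ ^ m = n := congrArg Subtype.val hm
  rw [← hm, map_zpow, MonoidHom.mul_apply, MonoidHom.zpow_apply, hk, mul_inv_cancel, one_zpow]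

variable [Finite L]

theorem card_of_sup_eq_top {N X : Subgroup L} (hN : N ≤ Subgroup.center L)
    (hc : Nat.card N = p) (hX : X ⊔ N = ⊤) (hX' : X ≠ ⊤) :
    N ⊓ X = ⊥ ∧ Nat.card L = p * Nat.card X := by
  have : N.Normal := normal_of_le_center hN
  have hinf : N ⊓ X = ⊥ := by
    have hd : Nat.card (N ⊓ X : Subgroup L) ∣ p := hc ▸ Subgroup.card_dvd_of_le inf_le_left
    rcases (Nat.dvd_prime hp.out).1 hd with h | h
    · exact Subgroup.card_eq_one.1 h
    · have := Subgroup.eq_of_le_of_card_ge (inf_le_left : N ⊓ X ≤ N) (by rw [h, hc])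
      rw [inf_eq_left] at this
      exact (hX' (by rw [← hX, sup_eq_left.2 this])).elim
  refine ⟨hinf, ?_⟩
  have h1 := card_inf_mul_relIndex N X
  rw [hinf, Subgroup.card_bot, one_mul, ← Subgroup.relIndex_sup_right, hX,
    Subgroup.relIndex_top_right] at h1
  rw [← h1, ← hc, Subgroup.card_mul_index]

/-- A proper `X` with `XN = L` has index `p` and is maximal, so it contributes `-|L| / p` to the
sum, against `|L|` from `X = L`. The sum vanishes exactly when there are `p` such `X`. -/
theorem card_complements {N : Subgroup L} (hN : N ≤ Subgroup.center L) (hc : Nat.card N = p)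
    (hm : mCoeff N = 0) : Nat.card {X : Subgroup L // X ⊔ N = ⊤ ∧ X ≠ ⊤} = p := by
  classical
  have := Fintype.ofFinite (Subgroup L)
  have : N.Normal := normal_of_le_center hN
  rw [mCoeff_eq_zero_iff] at hm
  have hset : (Finset.univ.filter fun X : Subgroup L => X ⊔ N = ⊤) =
      insert ⊤ (Finset.univ.filter fun X : Subgroup L => X ⊔ N = ⊤ ∧ X ≠ ⊤) := by
    ext X
    by_cases hX : X = ⊤ <;> simp [hX]
  rw [hset, Finset.sum_insert (by simp), subgroupMu_self, mul_one, Subgroup.card_top] at hm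
  have hterm : ∀ X ∈ Finset.univ.filter (fun X : Subgroup L => X ⊔ N = ⊤ ∧ X ≠ ⊤),
      (p : ℤ) * ((Nat.card X : ℤ) * subgroupMu X ⊤) = -(Nat.card L : ℤ) := by
    intro X hX
    obtain ⟨hX1, hX2⟩ := (Finset.mem_filter.1 hX).2
    have h1 := (card_of_sup_eq_top hN hc hX1 hX2).2
    have hco : IsCoatom X := by
      refine ⟨hX2, fun Z hZ => ?_⟩
      by_contra hZ'
      have h2 := (card_of_sup_eq_top hN hc
        (top_le_iff.1 (hX1 ▸ sup_le_sup_right hZ.le N)) hZ').2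
      have h3 : Nat.card Z = Nat.card X :=
        Nat.eq_of_mul_eq_mul_left hp.out.pos (h2.symm.trans h1)
      exact hZ.ne (Subgroup.eq_of_le_of_card_ge hZ.le h3.le)
    rw [subgroupMu_coatom hco, h1]
    push_cast
    ring
  have h1 := congrArg (fun z => (p : ℤ) * z) hm
  simp only [mul_add, Finset.mul_sum, mul_zero] at h1
  rw [Finset.sum_congr rfl hterm, Finset.sum_const, nsmul_eq_mul] at h1
  rw [Nat.card_eq_fintype_card, Fintype.card_subtype]
  have hL : (Nat.card L : ℤ) ≠ 0 := Nat.cast_ne_zero.2 Nat.card_pos.ne'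
  have h2 : ((p : ℤ) - (Finset.univ.filter fun X : Subgroup L => X ⊔ N = ⊤ ∧ X ≠ ⊤).card) *
      (Nat.card L : ℤ) = 0 := by
    linear_combination h1
  have h3 := (mul_eq_zero.1 h2).resolve_right hL
  exact Nat.cast_injective (R := ℤ) (sub_eq_zero.1 h3).symm

/-- Complements of `N` correspond to extensions to `L` of a fixed isomorphism `ν` from `N` to `C_p`.
There are `p` of them, and they form a torsor under the homomorphisms trivial on `N`. -/
theorem exists_retraction_and_card_homAnnihilator {N : Subgroup L} (hN : N ≤ Subgroup.center L)
    (hc : Nat.card N = p) (hm : mCoeff N = 0) :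
    (∃ f : L →* Cyc p, ∃ n ∈ N, f n ≠ 1) ∧ Nat.card (homAnnihilator p N) = p := by
  have : N.Normal := normal_of_le_center hN
  let ν : N ≃* Cyc p := mulEquivOfPrimeCardEq hc card_cyc
  obtain ⟨n₀, hn₀⟩ : ∃ n : N, n ≠ 1 := by
    have : Nontrivial N := Finite.one_lt_card_iff_nontrivial.1 (hc ▸ hp.out.one_lt)
    exact exists_ne 1
  have hν : ν n₀ ≠ 1 := fun h => hn₀ (ν.injective (h.trans (map_one ν).symm))
  have hker : ∀ f : L →* Cyc p, (∀ n : N, f n = ν n) → f.ker ⊔ N = ⊤ ∧ f.ker ≠ ⊤ := by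
    intro f hf
    constructor
    · rw [eq_top_iff]
      intro l _
      obtain ⟨n, hn⟩ := ν.surjective (f l)
      have h1 : l * (n : L)⁻¹ ∈ f.ker := by
        rw [MonoidHom.mem_ker, map_mul, map_inv, hf, hn, mul_inv_cancel]
      simpa using Subgroup.mul_mem_sup h1 n.2
    · intro h
      exact hν ((hf n₀).symm.trans (MonoidHom.mem_ker.1 (h ▸ Subgroup.mem_top _)))
  let T := {f : L →* Cyc p // ∀ n : N, f n = ν n}
  let κ : T → {X : Subgroup L // X ⊔ N = ⊤ ∧ X ≠ ⊤} := fun f => ⟨f.1.ker, hker f.1 f.2⟩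
  have hκ : Function.Bijective κ := by
    constructor
    · rintro ⟨f, hf⟩ ⟨g, hg⟩ h
      have h : f.ker = g.ker := congrArg Subtype.val h
      refine Subtype.ext (MonoidHom.ext fun l => ?_)
      obtain ⟨n, hn⟩ := ν.surjective (f l)
      have h1 : l * (n : L)⁻¹ ∈ f.ker := by
        rw [MonoidHom.mem_ker, map_mul, map_inv, hf, hn, mul_inv_cancel]
      have h2 : l * (n : L)⁻¹ ∈ g.ker := h ▸ h1
      rw [MonoidHom.mem_ker, map_mul, map_inv, hg, hn, mul_inv_eq_one] at h2
      exact h2.symm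
    · rintro ⟨X, hX1, hX2⟩
      -- `X` is normalized by itself and by the central `N`, which together generate `L`.
      have hXn : X.Normal := by
        rw [← Subgroup.normalizer_eq_top_iff, eq_top_iff, ← hX1]
        exact sup_le Subgroup.le_normalizer
          (hN.trans (Subgroup.center_le_normalizer _))
      have hinf := (card_of_sup_eq_top hN hc hX1 hX2).1
      have he : Function.Bijective ((QuotientGroup.mk' X).comp N.subtype) := by
        constructor
        · rw [← MonoidHom.ker_eq_bot_iff, eq_bot_iff]
          intro n hn
          have h1 : (n : L) ∈ N ⊓ X := ⟨n.2, (QuotientGroup.eq_one_iff _).1 hn⟩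
          rw [hinf] at h1
          exact Subtype.ext h1
        · rintro ⟨l⟩
          have hl : l ∈ ((X ⊔ N : Subgroup L) : Set L) := hX1 ▸ Subgroup.mem_top l
          rw [sup_comm, Subgroup.normal_mul] at hl
          obtain ⟨n, hn, x, hx, rfl⟩ := Set.mem_mul.1 hl
          refine ⟨⟨n, hn⟩, (QuotientGroup.eq (s := X)).2 ?_⟩
          change n⁻¹ * (n * x) ∈ X
          rwa [inv_mul_cancel_left]
      let e : N ≃* L ⧸ X := MulEquiv.ofBijective _ he
      let f : L →* Cyc p := ((e.symm.trans ν : L ⧸ X ≃* Cyc p) : L ⧸ X →* Cyc p).comp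
        (QuotientGroup.mk' X)
      refine ⟨⟨f, fun n => ?_⟩, Subtype.ext ?_⟩
      · exact congrArg ν (e.symm_apply_apply n)
      · change f.ker = X
        rw [MonoidHom.ker_mulEquiv_comp, QuotientGroup.ker_mk']
  have hT : Nat.card T = p :=
    (Nat.card_congr (Equiv.ofBijective κ hκ)).trans (card_complements hN hc hm)
  have hTn : Nonempty T := (Nat.card_pos_iff.1 (hT ▸ hp.out.pos)).1
  obtain ⟨f₀, hf₀⟩ := hTn
  refine ⟨⟨f₀, n₀, n₀.2, hf₀ n₀ ▸ hν⟩, ?_⟩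
  refine (Nat.card_congr ?_).trans hT
  refine ⟨fun f => ⟨f₀ * f.1, fun n => ?_⟩, fun g => ⟨f₀⁻¹ * g.1, fun n hn => ?_⟩,
    fun f => ?_, fun g => ?_⟩
  · rw [MonoidHom.mul_apply, f.2 n n.2, mul_one, hf₀]
  · rw [MonoidHom.mul_apply, MonoidHom.inv_apply, hf₀ ⟨n, hn⟩, g.2 ⟨n, hn⟩, inv_mul_cancel]
  · exact Subtype.ext (inv_mul_cancel_left _ _)
  · exact Subtype.ext (mul_inv_cancel_left _ _)

end Central

/-! ### Splitting off the kernel. -/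

section Classification

variable {K L : Type u} [Group K] [Group L] {φ : L →* K} {H : Subgroup K}

/-- A homomorphism onto `A × H` over `K`, when `A` splits off the kernel of `φ`. -/
theorem overIso_of_bijOn_ker {A : Type} [Group A] {ψ : L →* H} {k : K}
    (hψ : Function.Surjective ψ) (hk : ∀ l, (ψ l : K) = k * φ l * k⁻¹) (f : L →* A)
    (hf : Function.Bijective (f.comp φ.ker.subtype)) :
    OverIso φ (H.subtype.comp (MonoidHom.snd A H)) := by
  have hker : ∀ l, ψ l = 1 ↔ l ∈ φ.ker := by
    intro l
    rw [MonoidHom.mem_ker, Subtype.ext_iff, hk, Subgroup.coe_one, conj_eq_one_iff]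
  have hbij : Function.Bijective (f.prod ψ) := by
    constructor
    · rw [← MonoidHom.ker_eq_bot_iff, eq_bot_iff]
      intro l hl
      have h1 : f l = 1 := congrArg Prod.fst hl
      have h2 : l ∈ φ.ker := (hker l).1 (congrArg Prod.snd hl)
      have h3 : (⟨l, h2⟩ : φ.ker) = 1 := hf.1 (h1.trans (map_one _).symm)
      exact congrArg Subtype.val h3
    · rintro ⟨a, h⟩
      obtain ⟨l, rfl⟩ := hψ h
      obtain ⟨r, hr⟩ := hf.2 (a * (f l)⁻¹)
      have hr : f r = a * (f l)⁻¹ := hr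
      refine ⟨r * l, Prod.ext ?_ ?_⟩
      · change f (r * l) = a
        rw [map_mul, hr, inv_mul_cancel_right]
      · change ψ (r * l) = ψ l
        rw [map_mul, (hker r).2 r.2, one_mul]
  let e : L ≃* A × H := MulEquiv.ofBijective _ hbij
  have he : ∀ l, ((e l).2 : K) = k * φ l * k⁻¹ := hk
  refine ⟨e.toMonoidHom, e.symm.toMonoidHom, ⟨k, ?_⟩, ⟨k⁻¹, ?_⟩, ?_, ?_⟩
  · exact MonoidHom.ext fun l => (he l).symm
  · refine MonoidHom.ext fun z => ?_
    obtain ⟨l, rfl⟩ := e.surjective z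
    change k⁻¹ * ((e l).2 : K) * k⁻¹⁻¹ = φ (e.symm (e l))
    rw [he, e.symm_apply_apply]
    simp [mul_assoc]
  · exact MonoidHom.ext fun l => e.symm_apply_apply l
  · exact MonoidHom.ext fun z => e.apply_symm_apply z

theorem overIso_of_ker_eq_bot {ψ : L →* H} {k : K}
    (hψ : Function.Surjective ψ) (hk : ∀ l, (ψ l : K) = k * φ l * k⁻¹) (hφ : φ.ker = ⊥) :
    OverIso φ H.subtype := by
  have hbij : Function.Bijective ψ := by
    refine ⟨?_, hψ⟩
    rw [← MonoidHom.ker_eq_bot_iff, eq_bot_iff, ← hφ]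
    intro l hl
    have h1 := hk l
    rw [MonoidHom.mem_ker.1 hl, Subgroup.coe_one, eq_comm, conj_eq_one_iff] at h1
    exact h1
  let e : L ≃* H := MulEquiv.ofBijective _ hbij
  have he : ∀ l, (e l : K) = k * φ l * k⁻¹ := hk
  refine ⟨e.toMonoidHom, e.symm.toMonoidHom, ⟨k, ?_⟩, ⟨k⁻¹, ?_⟩, ?_, ?_⟩
  · exact MonoidHom.ext fun l => (he l).symm
  · refine MonoidHom.ext fun z => ?_
    obtain ⟨l, rfl⟩ := e.surjective z
    change k⁻¹ * (e l : K) * k⁻¹⁻¹ = φ (e.symm (e l))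
    rw [he, e.symm_apply_apply]
    simp [mul_assoc]
  · exact MonoidHom.ext fun l => e.symm_apply_apply l
  · exact MonoidHom.ext fun z => e.apply_symm_apply z

theorem exists_surjective_of_subgroupConj (hφ : SubgroupConj φ.range H) :
    ∃ (ψ : L →* H) (k : K), Function.Surjective ψ ∧ ∀ l, (ψ l : K) = k * φ l * k⁻¹ := by
  obtain ⟨k, rfl⟩ := hφ
  refine ⟨((MulAut.conj k).toMonoidHom.comp φ).codRestrict _ fun l => ⟨φ l, ⟨l, rfl⟩, rfl⟩, k,
    ?_, fun l => rfl⟩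
  rintro ⟨_, _, ⟨l, rfl⟩, rfl⟩
  exact ⟨l, rfl⟩

variable {p : ℕ} [hp : Fact p.Prime]

theorem card_homAnnihilator_ker {ψ : L →* H} {k : K}
    (hψ : Function.Surjective ψ) (hk : ∀ l, (ψ l : K) = k * φ l * k⁻¹) :
    Nat.card (H →* Cyc p) = Nat.card (homAnnihilator p φ.ker) := by
  have hker : ψ.ker = φ.ker := by
    ext l
    rw [MonoidHom.mem_ker, MonoidHom.mem_ker, Subtype.ext_iff, hk, Subgroup.coe_one,
      conj_eq_one_iff]
  refine Nat.card_congr (Equiv.ofBijective (fun f => ⟨f.comp ψ, fun n hn => ?_⟩) ⟨?_, ?_⟩)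
  · rw [← hker] at hn
    rw [MonoidHom.comp_apply, MonoidHom.mem_ker.1 hn, map_one]
  · intro f g h
    exact (MonoidHom.cancel_right hψ).1 (congrArg Subtype.val h)
  · rintro ⟨f, hf⟩
    refine ⟨ψ.liftOfSurjective hψ ⟨f, fun l hl => hf l (hker ▸ hl)⟩, Subtype.ext ?_⟩
    exact MonoidHom.ext fun l => MonoidHom.liftOfRightInverse_comp_apply _ _ (Function.rightInverse_surjInv hψ) _ l

variable [Finite L]

/-- Each non-trivial normal subgroup in the kernel yields a map to `C_p` that is non-trivial on it.
Since the annihilator of the first central `N` has order `p`, two such maps suffice to separate the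
kernel. -/
theorem classification_of_ker_inf_pResidual_eq_bot (hB : IsBGroup φ)
    (hR : φ.ker ⊓ pResidual p L = ⊥) (hφ : SubgroupConj φ.range H) :
    (φ.ker = ⊥ ∧ OverIso φ H.subtype) ∨
    (Nonempty (φ.ker ≃* Cyc p) ∧ (IsCyclic (pQuot p H) ∧ Nontrivial (pQuot p H)) ∧
      OverIso φ (H.subtype.comp (MonoidHom.snd (Cyc p) H))) ∨
    (Nonempty (φ.ker ≃* Cyc p × Cyc p) ∧ Subsingleton (pQuot p H) ∧
      OverIso φ (H.subtype.comp (MonoidHom.snd (Cyc p × Cyc p) H))) := by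
  obtain ⟨ψ, k, hψ, hk⟩ := exists_surjective_of_subgroupConj hφ
  have hHfin : Finite H := Finite.of_surjective ψ hψ
  by_cases hbot : φ.ker = ⊥
  · exact Or.inl ⟨hbot, overIso_of_ker_eq_bot hψ hk hbot⟩
  right
  have hcentral : ∀ A : Subgroup L, A.Normal → A ≤ φ.ker → A ≠ ⊥ →
      ∃ N ≤ A, Nat.card N = p ∧ (∃ f : L →* Cyc p, ∃ n ∈ N, f n ≠ 1) ∧
        Nat.card (homAnnihilator p N) = p := by
    intro A hA hle hne
    obtain ⟨N, hNA, hNc, hN⟩ := exists_central_card_eq (p := p) hne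
      (le_bot_iff.1 (hR ▸ inf_le_inf_right _ hle))
    refine ⟨N, hNA, hN, exists_retraction_and_card_homAnnihilator hNc hN
      (hB N (normal_of_le_center hNc) (hNA.trans hle) ?_)⟩
    rintro rfl
    rw [Subgroup.card_bot] at hN
    exact hp.out.ne_one hN.symm
  obtain ⟨N, hNR, hN, ⟨f₀, n₀, hn₀, hf₀⟩, hV⟩ := hcentral φ.ker inferInstance le_rfl hbot
  have hgen : ∀ {x : Cyc p}, x ≠ 1 → ∀ y, ∃ m : ℤ, x ^ m = y := fun hx y =>
    Subgroup.mem_zpowers_iff.1 (mem_zpowers_of_prime_card card_cyc hx)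
  by_cases hA : φ.ker ⊓ f₀.ker = ⊥
  · left
    have hbij : Function.Bijective (f₀.comp φ.ker.subtype) := by
      constructor
      · rw [← MonoidHom.ker_eq_bot_iff, eq_bot_iff]
        intro r hr
        have : (r : L) ∈ φ.ker ⊓ f₀.ker := ⟨r.2, hr⟩
        rw [hA] at this
        exact Subtype.ext this
      · intro y
        obtain ⟨m, rfl⟩ := hgen hf₀ y
        exact ⟨⟨n₀, hNR hn₀⟩ ^ m, map_zpow f₀ n₀ m⟩
    have hcard : Nat.card φ.ker = p := (Nat.card_congr (Equiv.ofBijective _ hbij)).trans card_cyc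
    have hNeq : N = φ.ker := Subgroup.eq_of_le_of_card_ge hNR (by rw [hcard, hN])
    refine ⟨⟨MulEquiv.ofBijective _ hbij⟩, isCyclic_pQuot ?_, overIso_of_bijOn_ker hψ hk f₀ hbij⟩
    -- Here `N` is the whole kernel, so maps from `H` to `C_p` are the maps from `L` trivial on `N`,
    -- and there are `p`.
    rw [card_homAnnihilator_ker hψ hk, ← hNeq, hV]
  · right
    obtain ⟨N₂, hN₂A, hN₂, ⟨f₁, n₂, hn₂, hf₁⟩, -⟩ :=
      hcentral (φ.ker ⊓ f₀.ker) inferInstance inf_le_left hA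
    have hn₂R : n₂ ∈ φ.ker := (hN₂A hn₂).1
    have hn₂f : f₀ n₂ = 1 := (hN₂A hn₂).2
    -- Multiplying by a power of `f₀` makes `f₁` trivial on `N` without changing its value at `n₂`,
    -- where `f₀` is trivial.
    obtain ⟨j, hj⟩ := exists_mul_zpow_mem_homAnnihilator hN hn₀ hf₀ f₁
    obtain ⟨f₂, hf₂V, hf₂⟩ : ∃ f₂ ∈ homAnnihilator p N, f₂ n₂ ≠ 1 :=
      ⟨_, hj, by rwa [MonoidHom.mul_apply, MonoidHom.zpow_apply, hn₂f, one_zpow, mul_one]⟩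
    have hVgen : ∀ g ∈ homAnnihilator p N, g ≠ 1 → ∀ h ∈ homAnnihilator p N, ∃ m : ℤ,
        g ^ m = h := by
      intro g hg hg1 h hh
      obtain ⟨m, hm⟩ := Subgroup.mem_zpowers_iff.1 (mem_zpowers_of_prime_card hV
        (g := (⟨g, hg⟩ : homAnnihilator p N)) (fun h => hg1 (congrArg Subtype.val h))
        (g' := ⟨h, hh⟩))
      exact ⟨m, congrArg Subtype.val hm⟩
    -- A third map, corrected by `f₀` in the same way, would be a power of `f₂`, hence trivial at
    -- `n₃`, where it must not be.
    have hBbot : φ.ker ⊓ f₀.ker ⊓ f₂.ker = ⊥ := by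
      by_contra hne
      obtain ⟨N₃, hN₃B, hN₃, ⟨f₃, n₃, hn₃, hf₃⟩, -⟩ :=
        hcentral (φ.ker ⊓ f₀.ker ⊓ f₂.ker) inferInstance (inf_le_left.trans inf_le_left) hne
      have h0 : f₀ n₃ = 1 := (hN₃B hn₃).1.2
      have h2 : f₂ n₃ = 1 := (hN₃B hn₃).2
      obtain ⟨i, hi⟩ := exists_mul_zpow_mem_homAnnihilator hN hn₀ hf₀ f₃
      have hf₂1 : f₂ ≠ 1 := fun h => hf₂ (by rw [h, MonoidHom.one_apply])
      obtain ⟨m, hm⟩ := hVgen f₂ hf₂V hf₂1 _ hi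
      have h3 := DFunLike.congr_fun hm n₃
      rw [MonoidHom.zpow_apply, h2, one_zpow, MonoidHom.mul_apply, MonoidHom.zpow_apply, h0,
        one_zpow, mul_one] at h3
      exact hf₃ h3.symm
    have hbij : Function.Bijective ((f₀.prod f₂).comp φ.ker.subtype) := by
      constructor
      · rw [← MonoidHom.ker_eq_bot_iff, eq_bot_iff]
        intro r hr
        have : (r : L) ∈ φ.ker ⊓ f₀.ker ⊓ f₂.ker :=
          ⟨⟨r.2, congrArg Prod.fst hr⟩, congrArg Prod.snd hr⟩
        rw [hBbot] at this
        exact Subtype.ext this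
      · rintro ⟨x, y⟩
        obtain ⟨m, rfl⟩ := hgen hf₀ x
        obtain ⟨m', rfl⟩ := hgen hf₂ y
        refine ⟨⟨n₀, hNR hn₀⟩ ^ m * ⟨n₂, hn₂R⟩ ^ m', Prod.ext ?_ ?_⟩
        · change f₀ (n₀ ^ m * n₂ ^ m') = _
          rw [map_mul, map_zpow, map_zpow, hn₂f, one_zpow, mul_one]
        · change f₂ (n₀ ^ m * n₂ ^ m') = _
          rw [map_mul, map_zpow, map_zpow, hf₂V n₀ hn₀, one_zpow, one_mul]
    refine ⟨⟨MulEquiv.ofBijective _ hbij⟩, subsingleton_pQuot fun g => ?_,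
      overIso_of_bijOn_ker hψ hk _ hbij⟩
    have hgR : ∀ r ∈ φ.ker, g.comp ψ r = 1 := by
      intro r hr
      have : ψ r = 1 := Subtype.ext (by
        rw [hk, MonoidHom.mem_ker.1 hr, mul_one, mul_inv_cancel, Subgroup.coe_one])
      rw [MonoidHom.comp_apply, this, map_one]
    -- A non-trivial map pulled back from `H` would generate the annihilator of `N`, making `f₂`
    -- trivial on the kernel, although `f₂ n₂ ≠ 1`.
    have hg : g.comp ψ = 1 := by
      by_contra hg1
      obtain ⟨m, hm⟩ := hVgen (g.comp ψ) (fun n hn => hgR n (hNR hn)) hg1 f₂ hf₂V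
      refine hf₂ ?_
      rw [← hm, MonoidHom.zpow_apply, hgR n₂ hn₂R, one_zpow]
    refine MonoidHom.ext fun h => ?_
    obtain ⟨l, rfl⟩ := hψ h
    exact DFunLike.congr_fun hg l

end Classification

theorem exactlyOne_of_or {a b c : Prop} (h : a ∨ b ∨ c) (hab : a → ¬ b) (hac : a → ¬ c)
    (hbc : b → ¬ c) : ExactlyOne a b c := by
  unfold ExactlyOne
  tauto

end RelBGroup

theorem mainTheorem9
    (F : Type w) [Field F] [CharZero F] (p : ℕ) [Fact p.Prime]
    (K : Type u) [Group K] [Finite K] (L : Type u) [Group L] [Finite L] (φ : L →* K)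
    (hB : RelBGroup.IsBGroup φ) (hp : RelBGroup.IsPersistent F p φ)
    (s : Set (Subgroup K)) (hs : RelBGroup.IsSubgroupReps s)
    (H : Subgroup K) (hH : H ∈ s) (hφ : RelBGroup.SubgroupConj φ.range H) :
    RelBGroup.ExactlyOne
      (φ.ker = ⊥ ∧
        RelBGroup.OverIso φ H.subtype)
      (Nonempty (φ.ker ≃* RelBGroup.Cyc p) ∧
        (IsCyclic (RelBGroup.pQuot p H) ∧ Nontrivial (RelBGroup.pQuot p H)) ∧
        RelBGroup.OverIso φ
          (H.subtype.comp (MonoidHom.snd (RelBGroup.Cyc p) H)))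
      (Nonempty (φ.ker ≃* RelBGroup.Cyc p × RelBGroup.Cyc p) ∧
        Subsingleton (RelBGroup.pQuot p H) ∧
        RelBGroup.OverIso φ
          (H.subtype.comp (MonoidHom.snd (RelBGroup.Cyc p × RelBGroup.Cyc p) H))) := by
  have hprime : p.Prime := Fact.out
  have h1 : φ.ker = ⊥ → Nat.card φ.ker = 1 := fun h => by rw [h, Subgroup.card_bot]
  have h2 : Nonempty (φ.ker ≃* RelBGroup.Cyc p) → Nat.card φ.ker = p := fun ⟨e⟩ =>
    (Nat.card_congr e.toEquiv).trans RelBGroup.card_cyc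
  have h3 : Nonempty (φ.ker ≃* RelBGroup.Cyc p × RelBGroup.Cyc p) → Nat.card φ.ker = p * p :=
    fun ⟨e⟩ => by rw [Nat.card_congr e.toEquiv, Nat.card_prod, RelBGroup.card_cyc]
  have hlt := hprime.one_lt
  -- The cases exclude each other because the kernel has order `1`, `p` or `p * p`, three distinct
  -- numbers.
  have hlt' : p < p * p := lt_mul_of_one_lt_left hprime.pos hlt
  refine RelBGroup.exactlyOne_of_or
    (RelBGroup.classification_of_ker_inf_pResidual_eq_bot hB
      (RelBGroup.ker_inf_pResidual_eq_bot F hB hp) hφ) ?_ ?_ ?_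
  · rintro ⟨a, -⟩ ⟨b, -⟩
    have := h1 a
    have := h2 b
    omega
  · rintro ⟨a, -⟩ ⟨c, -⟩
    have := h1 a
    have := h3 c
    omega
  · rintro ⟨b, -⟩ ⟨c, -⟩
    have := h2 b
    have := h3 c
    omega
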